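/- Let $a\ge 0$, $T>0$ and $R>R_0:=e^{(3e)^{-1}}(1+a)^{1/3}$ (so that $R_0>1$). Write $Pf=f'''+af'$ for functions $f$ on $[-1,0]$ (with one-sided derivatives at the end points), $P^0=\mathrm{Id}$, $P^n=P\circ P^{n-1}$. Let $\mathcal R_R$ be the set of real-valued $f\in C^0([-1,0])$ that are the restriction to $[-1,0]$ of a holomorphic function on the disk $D(0,R)=\{z\in\mathbb C:\ |z|<R\}$ and satisfy $(P^nf)(0)=\partial_x(P^nf)(0)=0$ for all $n\ge 0$. For $s\ge 0$, let $G^s([0,T])$ be the set of $u\in C^\infty([0,T])$ for which there are $C,\rho>0$ with $|u^{(n)}(t)|\le C\,(n!)^s/\rho^n$ for all $n\in\mathbb N$ and $t\in[0,T]$; and for $s_1,s_2\ge 0$ let $G^{s_1,s_2}([-1,0]\times[0,T])$ be the set of $y\in C^\infty([-1,0]\times[0,T])$ for which there are $C,\rho_1,\rho_2>0$ with $|\partial_x^{n_1}\partial_t^{n_2}y(x,t)|\le C\,(n_1!)^{s_1}(n_2!)^{s_2}/(\rho_1^{n_1}\rho_2^{n_2})$ for all $n_1,n_2\in\mathbb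 N$ and $(x,t)\in[-1,0]\times[0,T]$. Then for every $y_1\in\mathcal R_R$ there exists a control $u\in G^3([0,T])$ such that the system $$\begin{aligned} &\partial_ty+\partial_x^3y+a\,\partial_xy=0, && x\in(-1,0),\ t\in(0,T),\\ &y(0,t)=\partial_xy(0,t)=0,\quad y(-1,t)=u(t), && t\in(0,T),\\ &y(x,0)=0, && x\in(-1,0), \end{aligned}$$ has a classical solution $y$ ($C^3$ in $x$ and $C^1$ in $t$, with the corresponding derivatives continuous on $[-1,0]\times[0,T]$), this solution is unique, and it satisfies $y(x,T)=y_1(x)$ for all $x\in[-1,0]$. Furthermore, $y\in G^{1,3}([-1,0]\times[0,T])$. -/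

import Mathlib

open Set
open scoped ContDiff

namespace LinearKdV

/-- `u ∈ G^s([t₁, t₂])`: Gevrey functions of order `s` on a compact interval.  Derivatives are
taken within the interval (one-sided at the end points). -/
def Gevrey (s t₁ t₂ : ℝ) (u : ℝ → ℝ) : Prop :=
  ContDiffOn ℝ ∞ u (Icc t₁ t₂) ∧
    ∃ C R : ℝ, 0 < C ∧ 0 < R ∧ ∀ n : ℕ, ∀ t ∈ Icc t₁ t₂,
      |iteratedDerivWithin n u (Icc t₁ t₂) t| ≤ C * (n.factorial : ℝ) ^ s / R ^ n

/-- The partial derivative `∂ₓ^m ∂ₜ^n y (x, t)` of a function on the rectangle `X × S`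
(one-sided at the boundary). -/
noncomputable def partialDeriv (X S : Set ℝ) (m n : ℕ) (y : ℝ → ℝ → ℝ) (x t : ℝ) : ℝ :=
  iteratedDerivWithin m (fun ξ => iteratedDerivWithin n (fun τ => y ξ τ) S t) X x

/-- `y ∈ G^{s₁,s₂}([x₁, x₂] × [t₁, t₂])`: functions `y(x, t)` that are Gevrey of order `s₁` in `x`
and `s₂` in `t`. -/
def GevreyRect (s₁ s₂ x₁ x₂ t₁ t₂ : ℝ) (y : ℝ → ℝ → ℝ) : Prop :=
  ContDiffOn ℝ ∞ (fun p : ℝ × ℝ => y p.1 p.2) (Icc x₁ x₂ ×ˢ Icc t₁ t₂) ∧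
    ∃ C R₁ R₂ : ℝ, 0 < C ∧ 0 < R₁ ∧ 0 < R₂ ∧
      ∀ n₁ n₂ : ℕ, ∀ x ∈ Icc x₁ x₂, ∀ t ∈ Icc t₁ t₂,
        |partialDeriv (Icc x₁ x₂) (Icc t₁ t₂) n₁ n₂ y x t| ≤
          C * ((n₁.factorial : ℝ) ^ s₁ * (n₂.factorial : ℝ) ^ s₂) / (R₁ ^ n₁ * R₂ ^ n₂)

/-- The operator `P = ∂ₓ³ + a ∂ₓ` on functions on `[-1, 0]`. -/
noncomputable def P (a : ℝ) (f : ℝ → ℝ) : ℝ → ℝ := fun x =>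
  iteratedDerivWithin 3 f (Icc (-1) 0) x + a * derivWithin f (Icc (-1) 0) x

/-- The class `𝓡_R` (for `R > 1`): continuous functions on `[-1, 0]` that are restrictions of
holomorphic functions on `D(0, R)`, with `(Pⁿ y)(0) = ∂ₓ(Pⁿ y)(0) = 0` for all `n ≥ 0`. -/
def reachClass (a R : ℝ) : Set (ℝ → ℝ) :=
  {y | ContinuousOn y (Icc (-1) 0) ∧
    (∃ z : ℂ → ℂ, DifferentiableOn ℂ z (Metric.ball 0 R) ∧
      ∀ x ∈ Icc (-1 : ℝ) 0, (y x : ℂ) = z (x : ℂ)) ∧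
    ∀ n : ℕ, ((P a)^[n] y) 0 = 0 ∧ derivWithin ((P a)^[n] y) (Icc (-1) 0) 0 = 0}

/-- `R₀ = e^{1/(3e)} (1 + a)^{1/3}`. -/
noncomputable def R₀ (a : ℝ) : ℝ :=
  Real.exp ((3 * Real.exp 1)⁻¹) * (1 + a) ^ ((1 : ℝ) / 3)

/-- The requirement `R > 1` in the definition of `𝓡_R` is implied by `R > R₀`. -/
theorem one_lt_R₀ {a : ℝ} (ha : 0 ≤ a) : 1 < R₀ a := by
  have h1 : 1 < Real.exp ((3 * Real.exp 1)⁻¹) := Real.one_lt_exp_iff.2 (by positivity)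
  have h2 : 1 ≤ (1 + a) ^ ((1 : ℝ) / 3) := Real.one_le_rpow (by linarith) (by norm_num)
  unfold R₀
  nlinarith

/-- `y = y(x, t)` is a classical solution, of class `C³` in `x` and `C¹` in `t` up to the boundary of
`[-1, 0] × [0, T]`, of
`∂ₜy + ∂ₓ³y + a ∂ₓy = 0`, `y(0, t) = ∂ₓy(0, t) = 0`, `y(-1, t) = u(t)`, `y(x, 0) = y₀(x)`
for `x ∈ (-1, 0)`, `t ∈ (0, T)`. -/
structure IsSolution (a T : ℝ) (u y₀ : ℝ → ℝ) (y : ℝ → ℝ → ℝ) : Prop where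
  contDiff_x : ∀ t ∈ Icc 0 T, ContDiffOn ℝ 3 (fun x => y x t) (Icc (-1) 0)
  contDiff_t : ∀ x ∈ Icc (-1 : ℝ) 0, ContDiffOn ℝ 1 (fun t => y x t) (Icc 0 T)
  continuous_x : ∀ m ≤ 3, ContinuousOn
    (fun p : ℝ × ℝ => partialDeriv (Icc (-1) 0) (Icc 0 T) m 0 y p.1 p.2) (Icc (-1) 0 ×ˢ Icc 0 T)
  continuous_t : ContinuousOn
    (fun p : ℝ × ℝ => partialDeriv (Icc (-1) 0) (Icc 0 T) 0 1 y p.1 p.2) (Icc (-1) 0 ×ˢ Icc 0 T)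
  equation : ∀ x ∈ Ioo (-1 : ℝ) 0, ∀ t ∈ Ioo 0 T,
    partialDeriv (Icc (-1) 0) (Icc 0 T) 0 1 y x t
      + partialDeriv (Icc (-1) 0) (Icc 0 T) 3 0 y x t
      + a * partialDeriv (Icc (-1) 0) (Icc 0 T) 1 0 y x t = 0
  boundary_right : ∀ t ∈ Ioo 0 T, y 0 t = 0
  boundary_right_deriv : ∀ t ∈ Ioo 0 T, partialDeriv (Icc (-1) 0) (Icc 0 T) 1 0 y 0 t = 0
  boundary_left : ∀ t ∈ Ioo 0 T, y (-1) t = u t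
  initial : ∀ x ∈ Ioo (-1 : ℝ) 0, y x 0 = y₀ x

end LinearKdV

/-!
Reversing time turns the problem into finding a solution of `∂ₜY = P Y` on `[-1, 0] × [0, T]` with
`Y = ∂ₓY = 0` at `x = 0`, `Y(·, 0) = y₁` and `Y(·, T) = 0`; the control is read off at `x = -1`.
Such a solution is determined by its trace `w = ∂ₓ²Y(0, ·)`, and conversely any trace that is
Gevrey of order `2` has a solution, obtained by summing the Taylor series in `x`. So the trace
must have the derivatives `∂ₓ²Pⁿy₁(0)` at `t = 0`, which grow like `qⁿ (3n)!` with `q < 1` since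
`y₁` is holomorphic on a disk of radius greater than `1`, and must vanish near `T`.

This growth is of Gevrey order `3`, too fast for the Taylor series in `x` to be summed directly
near `t = 0`. Instead one superposes the solutions `e^{lt} G(x, l)` with `P G = l G`. The moments
`∫ lⁿ M` of the weight prescribe the derivatives of the trace at `t = 0`: writing
`l = κ³ e^{iθ} ζ³`, a Laplace integral over `ζ` on a ray produces `(3n)!`, and Fourier inversion
over `θ` produces the remaining bounded factor. The ray is turned with `θ` so as to keep `l` in
the left half plane. There `|G(x, l)|` grows at most like the exponential of `|l|^{1/3}` times the
largest real part of `-ω` over the unit cube roots `ω` of the direction of `l`, and the Laplace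
factor `e^{-ζ}` beats this growth exactly because `κ < 1`.

Since `l` stays in a sector of the left half plane, the trace is analytic for `t > 0`. Multiplying
it by a cutoff that is Gevrey of order `2`, equal to `0` near `t = 0` and to `1` near `T`, and
solving the Cauchy problem in `x` with the result as trace, gives a solution which is `0` at time
`0` and agrees with the superposition at time `T`; the difference of the two is the solution
sought. Uniqueness is the energy estimate for `∫ y² dx`.
-/

namespace LinearKdV

open Filter Topology MeasureTheory

/-! ### Elementary inequalities -/

theorem factorial_add_le (m n : ℕ) :
    ((m + n).factorial : ℝ) ≤ 2 ^ (m + n) * (m.factorial * n.factorial) := by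
  have hchoose : ((m + n).choose n : ℝ) ≤ 2 ^ (m + n) :=
    mod_cast Nat.choose_le_two_pow (m + n) n
  rw [← Nat.add_choose_mul_factorial_mul_factorial m n, mul_assoc]
  push_cast
  gcongr

theorem factorial_mul_factorial_le (m n : ℕ) :
    (m.factorial * n.factorial : ℝ) ≤ (m + n).factorial := mod_cast
  Nat.le_of_dvd (Nat.factorial_pos _) (Nat.factorial_mul_factorial_dvd_factorial_add m n)

theorem factorial_three_mul_le (n : ℕ) :
    ((3 * n).factorial : ℝ) ≤ 32 ^ n * (n.factorial : ℝ) ^ 3 :=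
  calc ((3 * n).factorial : ℝ) = (n + (n + n)).factorial := by congr 2; ring
    _ ≤ 2 ^ (n + (n + n)) * (n.factorial * (n + n).factorial) := factorial_add_le _ _
    _ ≤ 2 ^ (n + (n + n)) * (n.factorial * (2 ^ (n + n) * (n.factorial * n.factorial))) := by
      gcongr; exact factorial_add_le _ _
    _ = 32 ^ n * (n.factorial : ℝ) ^ 3 := by
      rw [show (32 : ℝ) = 2 ^ 5 by norm_num, ← pow_mul]; ring

theorem factorial_pow_three_le (n : ℕ) : (n.factorial : ℝ) ^ 3 ≤ (3 * n).factorial :=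
  calc (n.factorial : ℝ) ^ 3 = n.factorial * (n.factorial * n.factorial) := by ring
    _ ≤ n.factorial * (n + n).factorial := by gcongr; exact factorial_mul_factorial_le n n
    _ ≤ (n + (n + n)).factorial := factorial_mul_factorial_le _ _
    _ = (3 * n).factorial := by congr 2; ring

theorem pow_mul_exp_neg_le {c v : ℝ} (hc : 0 < c) (hv : 0 ≤ v) (n : ℕ) :
    v ^ n * Real.exp (-(c * v)) ≤ c⁻¹ ^ n * n.factorial := by
  have h := Real.pow_div_factorial_le_exp (c * v) (by positivity) n
  rw [div_le_iff₀ (by positivity), mul_pow] at h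
  rw [Real.exp_neg, inv_pow, ← div_eq_mul_inv, inv_mul_eq_div, div_le_div_iff₀ (by positivity)
    (by positivity)]
  linarith

theorem mul_pow_add_mul_pow_le {C D C' D' : ℝ} (hC : 0 ≤ C) (hD : 0 ≤ D) (hC' : 0 ≤ C')
    (hD' : 0 ≤ D') (n : ℕ) : C * D ^ n + C' * D' ^ n ≤ (C + C') * max D D' ^ n := by
  rw [add_mul]
  gcongr
  · exact le_max_left _ _
  · exact le_max_right _ _

/-! ### Sequences of successive derivatives -/

section DerivSeq

variable {E : Type*} [NormedAddCommGroup E] [NormedSpace ℝ E] {s : Set ℝ} {f g : ℕ → ℝ → E}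

/-- `f 0, f 1, f 2, …` are the successive derivatives of `f 0` within `s`. -/
def IsDerivSeq (s : Set ℝ) (f : ℕ → ℝ → E) : Prop :=
  ∀ m, ∀ x ∈ s, HasDerivWithinAt (f m) (f (m + 1) x) s x

namespace IsDerivSeq

theorem mono (hf : IsDerivSeq s f) {s' : Set ℝ} (h : s' ⊆ s) : IsDerivSeq s' f :=
  fun m x hx => (hf m x (h hx)).mono h

theorem sub (hf : IsDerivSeq s f) (hg : IsDerivSeq s g) :
    IsDerivSeq s (fun m x => f m x - g m x) :=
  fun m x hx => (hf m x hx).sub (hg m x hx)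

theorem comp_affine (hf : IsDerivSeq s f) {b c : ℝ} {s' : Set ℝ}
    (h : MapsTo (fun τ => b + c * τ) s' s) :
    IsDerivSeq s' (fun m τ => c ^ m • f m (b + c * τ)) := by
  intro m τ hτ
  have haff : HasDerivWithinAt (fun τ : ℝ => b + c * τ) c s' τ := by
    simpa using ((hasDerivWithinAt_id τ s').const_mul c).const_add b
  refine (((hf m _ (h hτ)).scomp τ haff h).const_smul (c ^ m)).congr_deriv ?_
  rw [smul_smul, ← pow_succ]

theorem iteratedDerivWithin_eq (hf : IsDerivSeq s f) (hs : UniqueDiffOn ℝ s) (k m : ℕ) {x : ℝ}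
    (hx : x ∈ s) : iteratedDerivWithin k (f m) s x = f (m + k) x := by
  induction k generalizing x with
  | zero => simp
  | succ k ih =>
    rw [iteratedDerivWithin_succ, derivWithin_congr (fun y hy => ih hy) (ih hx)]
    exact (hf (m + k) x hx).derivWithin (hs x hx)

theorem norm_le_of_zero_left (hf : IsDerivSeq (Icc 0 1) f) {C D : ℝ}
    (hb : ∀ m, ∀ x ∈ Icc (0 : ℝ) 1, ‖f m x‖ ≤ C * D ^ m * m.factorial) (h0 : ∀ m, f m 0 = 0)
    (N m : ℕ) {x : ℝ} (hx : x ∈ Icc (0 : ℝ) 1) :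
    ‖f m x‖ ≤ C * D ^ (m + N) * (m + N).factorial * (x ^ N / N.factorial) := by
  induction N generalizing m x with
  | zero => simpa using hb m x hx
  | succ N ih =>
    set A : ℝ := C * D ^ (m + (N + 1)) * (m + (N + 1)).factorial
    refine image_norm_le_of_norm_deriv_right_le_deriv_boundary (f := f m) (f' := f (m + 1))
      (B := fun x => A * (x ^ (N + 1) / (N + 1).factorial))
      (B' := fun x => A * (x ^ N / N.factorial))
      (fun y hy => (hf m y hy).continuousWithinAt) (fun y hy => ?_) (by simp [h0]) (fun y => ?_)
      (fun y hy => ?_) hx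
    · exact (hf m y (Ico_subset_Icc_self hy)).mono_of_mem_nhdsWithin
        (mem_of_superset (Icc_mem_nhdsGE hy.2) (Icc_subset_Icc_left hy.1))
    · refine (((hasDerivAt_pow (N + 1) y).div_const ((N + 1).factorial : ℝ)).const_mul
        A).congr_deriv ?_
      rw [Nat.factorial_succ]
      push_cast
      field_simp
    · have := ih (m + 1) (Ico_subset_Icc_self hy)
      rwa [show m + 1 + N = m + (N + 1) by ring] at this

theorem eq_zero_right_of_lt_half (hf : IsDerivSeq (Icc 0 1) f) {C D : ℝ} (hC : 0 ≤ C) (hD : 0 ≤ D)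
    (hD' : D < 1 / 2) (hb : ∀ m, ∀ x ∈ Icc (0 : ℝ) 1, ‖f m x‖ ≤ C * D ^ m * m.factorial)
    (h0 : ∀ m, f m 0 = 0) (m : ℕ) : f m 1 = 0 := by
  have hlim : Tendsto (fun N : ℕ => C * (2 * D) ^ m * m.factorial * (2 * D) ^ N) atTop (𝓝 0) := by
    simpa using (tendsto_pow_atTop_nhds_zero_of_lt_one (by positivity)
      (by linarith : 2 * D < 1)).const_mul (C * (2 * D) ^ m * m.factorial)
  refine norm_le_zero_iff.1 (ge_of_tendsto' hlim fun N => ?_)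
  calc ‖f m 1‖ ≤ C * D ^ (m + N) * (m + N).factorial * (1 ^ N / N.factorial) :=
        norm_le_of_zero_left hf hb h0 N m ⟨zero_le_one, le_rfl⟩
    _ ≤ C * D ^ (m + N) * (2 ^ (m + N) * (m.factorial * N.factorial)) * (1 ^ N / N.factorial) := by
      gcongr; exact factorial_add_le m N
    _ = C * (2 * D) ^ m * m.factorial * (2 * D) ^ N := by
      rw [one_pow, pow_add, pow_add, mul_pow, mul_pow]
      field_simp

theorem eq_zero_of_near (hf : IsDerivSeq s f) (hs : Convex ℝ s) {C D : ℝ} (hC : 0 ≤ C)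
    (hD : 0 ≤ D) (hb : ∀ m, ∀ x ∈ s, ‖f m x‖ ≤ C * D ^ m * m.factorial) {c y : ℝ} (hc : c ∈ s)
    (hy : y ∈ s) (hcy : D * |y - c| < 1 / 2) (h0 : ∀ m, f m c = 0) (m : ℕ) : f m y = 0 := by
  rcases eq_or_ne y c with rfl | hne
  · exact h0 m
  have hmaps : MapsTo (fun τ : ℝ => c + (y - c) * τ) (Icc 0 1) s := fun τ hτ => by
    simpa [mul_comm] using hs.add_smul_sub_mem hc hy hτ
  have hzero : (y - c) ^ m • f m (c + (y - c) * 1) = 0 := by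
    refine (hf.comp_affine hmaps).eq_zero_right_of_lt_half hC (by positivity) hcy
      (fun m τ hτ => ?_) (by simp [h0]) m
    calc ‖(y - c) ^ m • f m (c + (y - c) * τ)‖ ≤ |y - c| ^ m * (C * D ^ m * m.factorial) := by
          rw [norm_smul, norm_pow, Real.norm_eq_abs]
          gcongr
          exact hb m _ (hmaps hτ)
      _ = C * (D * |y - c|) ^ m * m.factorial := by rw [mul_pow]; ring
  simpa [sub_ne_zero.2 hne] using hzero

theorem eq_zero_of_analytic_bound (hf : IsDerivSeq s f) (hs : Convex ℝ s) {C D : ℝ} (hC : 0 ≤ C)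
    (hD : 0 ≤ D) (hb : ∀ m, ∀ x ∈ s, ‖f m x‖ ≤ C * D ^ m * m.factorial) {x₀ x : ℝ} (hx₀ : x₀ ∈ s)
    (hx : x ∈ s) (h0 : ∀ m, f m x₀ = 0) (m : ℕ) : f m x = 0 := by
  obtain ⟨K, hK⟩ := exists_nat_gt (2 * (D * |x - x₀|))
  have hK0 : (0 : ℝ) < K := lt_of_le_of_lt (by positivity) hK
  set c : ℕ → ℝ := fun j => x₀ + (j / K : ℝ) • (x - x₀) with hc
  have hmem : ∀ j ≤ K, c j ∈ s := fun j hj => hs.add_smul_sub_mem hx₀ hx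
    ⟨by positivity, div_le_one_of_le₀ (by exact_mod_cast hj) hK0.le⟩
  have hstep : ∀ j, D * |c (j + 1) - c j| < 1 / 2 := fun j => by
    have : c (j + 1) - c j = (x - x₀) / K := by simp only [hc, smul_eq_mul]; push_cast; ring
    rw [this, abs_div, abs_of_pos hK0, mul_div_assoc', div_lt_iff₀ hK0]
    linarith
  have hvanish : ∀ j ≤ K, ∀ m, f m (c j) = 0 := by
    intro j
    induction j with
    | zero => simpa [hc] using h0
    | succ j ih =>
      exact fun hj => hf.eq_zero_of_near hs hC hD hb (hmem j (by omega)) (hmem _ hj) (hstep j)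
        (ih (by omega))
  simpa [hc, hK0.ne'] using hvanish K le_rfl m

theorem eqOn_of_analytic_bound (hf : IsDerivSeq s f) (hg : IsDerivSeq s g) (hs : Convex ℝ s)
    {C D C' D' : ℝ} (hC : 0 ≤ C) (hD : 0 ≤ D) (hC' : 0 ≤ C') (hD' : 0 ≤ D')
    (hb : ∀ m, ∀ x ∈ s, ‖f m x‖ ≤ C * D ^ m * m.factorial)
    (hb' : ∀ m, ∀ x ∈ s, ‖g m x‖ ≤ C' * D' ^ m * m.factorial) {x₀ : ℝ} (hx₀ : x₀ ∈ s)
    (h0 : ∀ m, f m x₀ = g m x₀) : EqOn (f 0) (g 0) s := by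
  intro x hx
  refine sub_eq_zero.1 ((hf.sub hg).eq_zero_of_analytic_bound hs (C := C + C') (D := max D D')
    (by positivity) (by positivity) (fun m x hx => ?_) hx₀ hx (by simp [h0]) 0)
  calc ‖f m x - g m x‖ ≤ C * D ^ m * m.factorial + C' * D' ^ m * m.factorial :=
        (norm_sub_le _ _).trans (add_le_add (hb m x hx) (hb' m x hx))
    _ = (C * D ^ m + C' * D' ^ m) * m.factorial := by ring
    _ ≤ (C + C') * max D D' ^ m * m.factorial := by
      gcongr; exact mul_pow_add_mul_pow_le hC hD hC' hD' m

end IsDerivSeq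

end DerivSeq

/-! ### Families of partial derivatives -/

section Partial

variable {E : Type*} [NormedAddCommGroup E] [NormedSpace ℝ E] {X S : Set ℝ} {f fx : ℝ → ℝ → E}
  {x t : ℝ}

theorem isLittleO_sub_of_hasDerivWithinAt_fst (hX : Convex ℝ X) (hx : x ∈ X)
    (hfx : ∀ ξ ∈ X, ∀ τ ∈ S, HasDerivWithinAt (fun ξ => f ξ τ) (fx ξ τ) X ξ)
    (hcont : ContinuousWithinAt (fun p : ℝ × ℝ => fx p.1 p.2) (X ×ˢ S) (x, t)) :
    (fun p : ℝ × ℝ => f p.1 p.2 - f x p.2 - (p.1 - x) • fx x t) =o[𝓝[X ×ˢ S] (x, t)]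
      fun p => p - (x, t) := by
  refine Asymptotics.isLittleO_iff.2 fun ε hε => ?_
  obtain ⟨δ, hδ, hclose⟩ := Metric.continuousWithinAt_iff.1 hcont ε hε
  filter_upwards [self_mem_nhdsWithin, mem_nhdsWithin_of_mem_nhds (Metric.ball_mem_nhds _ hδ)]
    with ⟨y, τ⟩ ⟨hy, hτ⟩ hball
  have hseg : uIcc x y ⊆ X := hX.ordConnected.uIcc_subset hx hy
  have hmv : ‖f y τ - y • fx x t - (f x τ - x • fx x t)‖ ≤ ε * ‖y - x‖ := by
    refine (convex_uIcc x y).norm_image_sub_le_of_norm_hasDerivWithin_le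
      (f := fun ξ => f ξ τ - ξ • fx x t) (f' := fun ξ => fx ξ τ - (1 : ℝ) • fx x t)
      (fun ξ hξ => ((hfx ξ (hseg hξ) τ hτ).mono hseg).sub
        ((hasDerivWithinAt_id ξ _).smul_const (fx x t)))
      (fun ξ hξ => ?_) left_mem_uIcc right_mem_uIcc
    rw [one_smul, ← dist_eq_norm]
    refine (hclose (x := (ξ, τ)) ⟨hseg hξ, hτ⟩ (lt_of_le_of_lt ?_ hball)).le
    rw [Prod.dist_eq, Prod.dist_eq]
    exact max_le_max (abs_sub_left_of_mem_uIcc hξ) le_rfl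
  calc ‖f y τ - f x τ - (y - x) • fx x t‖ = ‖f y τ - y • fx x t - (f x τ - x • fx x t)‖ := by
        rw [sub_smul]; congr 1; abel
    _ ≤ ε * ‖y - x‖ := hmv
    _ ≤ ε * ‖(y, τ) - (x, t)‖ := by gcongr; exact norm_fst_le ((y, τ) - (x, t))

theorem hasFDerivWithinAt_prod_of_hasDerivWithinAt (hX : Convex ℝ X) (hx : x ∈ X)
    (hfx : ∀ ξ ∈ X, ∀ τ ∈ S, HasDerivWithinAt (fun ξ => f ξ τ) (fx ξ τ) X ξ)
    (hcont : ContinuousWithinAt (fun p : ℝ × ℝ => fx p.1 p.2) (X ×ˢ S) (x, t)) {v : E}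
    (hft : HasDerivWithinAt (f x) v S t) :
    HasFDerivWithinAt (fun p : ℝ × ℝ => f p.1 p.2)
      ((ContinuousLinearMap.fst ℝ ℝ ℝ).smulRight (fx x t)
        + (ContinuousLinearMap.snd ℝ ℝ ℝ).smulRight v) (X ×ˢ S) (x, t) := by
  have htime : (fun p : ℝ × ℝ => f x p.2 - f x t - (p.2 - t) • v) =o[𝓝[X ×ˢ S] (x, t)]
      fun p => p - (x, t) := by
    have hsnd : Tendsto Prod.snd (𝓝[X ×ˢ S] (x, t)) (𝓝[S] t) :=
      (continuous_snd.continuousWithinAt (s := X ×ˢ S) (x := (x, t))).tendsto_nhdsWithin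
        fun p hp => hp.2
    exact ((hasDerivWithinAt_iff_isLittleO.1 hft).comp_tendsto hsnd).trans_isBigO
      (Asymptotics.isBigO_of_le _ fun p => norm_snd_le (p - (x, t)))
  rw [hasFDerivWithinAt_iff_isLittleO]
  refine ((isLittleO_sub_of_hasDerivWithinAt_fst hX hx hfx hcont).add htime).congr_left fun p => ?_
  simp only [add_apply, ContinuousLinearMap.smulRight_apply,
    ContinuousLinearMap.coe_fst', ContinuousLinearMap.coe_snd', Prod.fst_sub, Prod.snd_sub]
  abel

end Partial

/-- `F m n` is the partial derivative `∂ₓ^m ∂ₜ^n` of `F 0 0` on `X × S`, and all these derivatives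
are bounded. -/
structure IsPartialFamily (X S : Set ℝ) (F : ℕ → ℕ → ℝ → ℝ → ℝ) : Prop where
  derivSeq_x : ∀ n, ∀ t ∈ S, IsDerivSeq X (fun m x => F m n x t)
  derivSeq_t : ∀ m, ∀ x ∈ X, IsDerivSeq S (fun n t => F m n x t)
  bounded : ∀ m n, ∃ K, ∀ x ∈ X, ∀ t ∈ S, |F m n x t| ≤ K

namespace IsPartialFamily

variable {X S : Set ℝ} {F : ℕ → ℕ → ℝ → ℝ → ℝ}

theorem continuousOn (hF : IsPartialFamily X S F) (hX : Convex ℝ X) (hS : Convex ℝ S) (m n : ℕ) :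
    ContinuousOn (fun p : ℝ × ℝ => F m n p.1 p.2) (X ×ˢ S) := by
  obtain ⟨K, hK⟩ := hF.bounded (m + 1) n
  obtain ⟨L, hL⟩ := hF.bounded m (n + 1)
  rintro ⟨x, t⟩ ⟨hx, ht⟩
  refine tendsto_iff_norm_sub_tendsto_zero.2 (squeeze_zero_norm' (a := fun p : ℝ × ℝ =>
    K * |p.1 - x| + L * |p.2 - t|) ?_ ?_)
  · filter_upwards [self_mem_nhdsWithin] with ⟨y, s⟩ ⟨hy, hs⟩
    rw [norm_norm, ← sub_add_sub_cancel _ (F m n x s)]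
    exact (norm_add_le _ _).trans (add_le_add
      (hX.norm_image_sub_le_of_norm_hasDerivWithin_le (hF.derivSeq_x n s hs m)
        (fun ξ hξ => hK ξ hξ s hs) hx hy)
      (hS.norm_image_sub_le_of_norm_hasDerivWithin_le (hF.derivSeq_t m x hx n)
        (fun τ hτ => hL x hx τ hτ) ht hs))
  · refine tendsto_nhdsWithin_of_tendsto_nhds ?_
    have : Continuous fun p : ℝ × ℝ => K * |p.1 - x| + L * |p.2 - t| := by fun_prop
    simpa using this.tendsto (x, t)

theorem hasFDerivWithinAt (hF : IsPartialFamily X S F) (hX : Convex ℝ X) (hS : Convex ℝ S)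
    (m n : ℕ) {p : ℝ × ℝ} (hp : p ∈ X ×ˢ S) :
    HasFDerivWithinAt (fun p : ℝ × ℝ => F m n p.1 p.2)
      ((ContinuousLinearMap.fst ℝ ℝ ℝ).smulRight (F (m + 1) n p.1 p.2)
        + (ContinuousLinearMap.snd ℝ ℝ ℝ).smulRight (F m (n + 1) p.1 p.2)) (X ×ˢ S) p :=
  hasFDerivWithinAt_prod_of_hasDerivWithinAt hX hp.1
    (fun ξ hξ τ hτ => hF.derivSeq_x n τ hτ m ξ hξ) (hF.continuousOn hX hS (m + 1) n p hp)
    (hF.derivSeq_t m p.1 hp.1 n p.2 hp.2)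

theorem contDiffOn (hF : IsPartialFamily X S F) (hX : Convex ℝ X) (hS : Convex ℝ S)
    (hX' : UniqueDiffOn ℝ X) (hS' : UniqueDiffOn ℝ S) (m n : ℕ) :
    ContDiffOn ℝ ∞ (fun p : ℝ × ℝ => F m n p.1 p.2) (X ×ˢ S) := by
  rw [contDiffOn_infty]
  intro k
  induction k generalizing m n with
  | zero => simpa using! hF.continuousOn hX hS m n
  | succ k ih =>
    push_cast
    rw [contDiffOn_succ_iff_hasFDerivWithinAt_of_uniqueDiffOn (hX'.prod hS')]
    refine ⟨by simp, _, ?_, fun p hp => hF.hasFDerivWithinAt hX hS m n hp⟩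
    exact (contDiffOn_const.smulRight (ih (m + 1) n)).add
      (contDiffOn_const.smulRight (ih m (n + 1)))

theorem partialDeriv_eq (hF : IsPartialFamily X S F) (hX' : UniqueDiffOn ℝ X)
    (hS' : UniqueDiffOn ℝ S) (m n : ℕ) {x t : ℝ} (hx : x ∈ X) (ht : t ∈ S) :
    partialDeriv X S m n (F 0 0) x t = F m n x t := by
  have htime : EqOn (fun ξ => iteratedDerivWithin n (fun τ => F 0 0 ξ τ) S t)
      (fun ξ => F 0 n ξ t) X := fun ξ hξ => by
    simpa using (hF.derivSeq_t 0 ξ hξ).iteratedDerivWithin_eq hS' n 0 ht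
  rw [partialDeriv, iteratedDerivWithin_congr htime hx]
  simpa using (hF.derivSeq_x n t ht).iteratedDerivWithin_eq hX' m 0 hx

end IsPartialFamily

/-! ### Uniqueness of classical solutions -/

section ParametricIntegral

variable {E : Type*} [NormedAddCommGroup E] {α β : ℝ} {S : Set ℝ} {f : ℝ → ℝ → E}

theorem continuousOn_left_of_prod (hf : ContinuousOn (fun p : ℝ × ℝ => f p.1 p.2) (Icc α β ×ˢ S))
    {t : ℝ} (ht : t ∈ S) : ContinuousOn (fun x => f x t) (Icc α β) :=
  hf.comp (f := fun x : ℝ => (x, t)) (by fun_prop) fun _ hx => ⟨hx, ht⟩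

theorem continuousOn_right_of_prod (hf : ContinuousOn (fun p : ℝ × ℝ => f p.1 p.2) (Icc α β ×ˢ S))
    {x : ℝ} (hx : x ∈ Icc α β) : ContinuousOn (f x) S :=
  hf.comp (f := fun t : ℝ => (x, t)) (by fun_prop) fun _ ht => ⟨hx, ht⟩

theorem aestronglyMeasurable_uIoc_of_continuousOn {g : ℝ → E} (hαβ : α ≤ β)
    (hg : ContinuousOn g (Icc α β)) : AEStronglyMeasurable g (volume.restrict (uIoc α β)) := by
  rw [uIoc_of_le hαβ]
  exact (hg.mono Ioc_subset_Icc_self).aestronglyMeasurable measurableSet_Ioc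

variable [NormedSpace ℝ E]

theorem continuousOn_intervalIntegral_of_prod (hαβ : α ≤ β) (hS : IsCompact S)
    (hf : ContinuousOn (fun p : ℝ × ℝ => f p.1 p.2) (Icc α β ×ˢ S)) :
    ContinuousOn (fun t => ∫ x in α..β, f x t) S := by
  obtain ⟨M, hM⟩ := (isCompact_Icc.prod hS).exists_bound_of_continuousOn hf
  have hmem : ∀ x ∈ uIoc α β, x ∈ Icc α β := fun x hx =>
    Ioc_subset_Icc_self (uIoc_of_le hαβ ▸ hx)
  intro t ht
  refine intervalIntegral.continuousWithinAt_of_dominated_interval (bound := fun _ => M) ?_ ?_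
    intervalIntegrable_const
    (ae_of_all _ fun x hx => continuousOn_right_of_prod hf (hmem x hx) t ht)
  · filter_upwards [self_mem_nhdsWithin] with s hs
    exact aestronglyMeasurable_uIoc_of_continuousOn hαβ (continuousOn_left_of_prod hf hs)
  · filter_upwards [self_mem_nhdsWithin] with s hs
    exact ae_of_all _ fun x hx => hM (x, s) ⟨hmem x hx, hs⟩

theorem hasDerivAt_intervalIntegral_of_prod (hαβ : α ≤ β) {f' : ℝ → ℝ → E} {t₀ t₁ : ℝ}
    (hf : ContinuousOn (fun p : ℝ × ℝ => f p.1 p.2) (Icc α β ×ˢ Icc t₀ t₁))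
    (hf' : ContinuousOn (fun p : ℝ × ℝ => f' p.1 p.2) (Icc α β ×ˢ Icc t₀ t₁))
    (hderiv : ∀ x ∈ Icc α β, ∀ t ∈ Ioo t₀ t₁, HasDerivAt (f x) (f' x t) t)
    {t : ℝ} (ht : t ∈ Ioo t₀ t₁) :
    HasDerivAt (fun t => ∫ x in α..β, f x t) (∫ x in α..β, f' x t) t := by
  obtain ⟨M, hM⟩ := (isCompact_Icc.prod isCompact_Icc).exists_bound_of_continuousOn hf'
  have hmem : ∀ x ∈ uIoc α β, x ∈ Icc α β := fun x hx =>
    Ioc_subset_Icc_self (uIoc_of_le hαβ ▸ hx)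
  have ht' := Ioo_subset_Icc_self ht
  refine (intervalIntegral.hasDerivAt_integral_of_dominated_loc_of_deriv_le
    (F := fun t x => f x t) (F' := fun t x => f' x t) (bound := fun _ => M)
    (Ioo_mem_nhds ht.1 ht.2) ?_ ((continuousOn_left_of_prod hf ht').intervalIntegrable_of_Icc hαβ)
    (aestronglyMeasurable_uIoc_of_continuousOn hαβ (continuousOn_left_of_prod hf' ht'))
    (ae_of_all _ fun x hx s hs => hM (x, s) ⟨hmem x hx, Ioo_subset_Icc_self hs⟩)
    intervalIntegrable_const (ae_of_all _ fun x hx s hs => hderiv x (hmem x hx) s hs)).2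
  filter_upwards [Ioo_mem_nhds ht.1 ht.2] with s hs
  exact aestronglyMeasurable_uIoc_of_continuousOn hαβ
    (continuousOn_left_of_prod hf (Ioo_subset_Icc_self hs))

end ParametricIntegral

theorem intervalIntegral_congr_Ioo {α β : ℝ} (hαβ : α ≤ β) {f g : ℝ → ℝ}
    (h : EqOn f g (Ioo α β)) : ∫ x in α..β, f x = ∫ x in α..β, g x := by
  simp only [intervalIntegral.integral_of_le hαβ, integral_Ioc_eq_integral_Ioo]
  exact setIntegral_congr_fun measurableSet_Ioo h

theorem integral_two_mul_mul_airy {α β a : ℝ} (hαβ : α ≤ β) {f f₁ f₂ f₃ : ℝ → ℝ}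
    (h₁ : ∀ x ∈ Icc α β, HasDerivWithinAt f (f₁ x) (Icc α β) x)
    (h₂ : ∀ x ∈ Icc α β, HasDerivWithinAt f₁ (f₂ x) (Icc α β) x)
    (h₃ : ∀ x ∈ Icc α β, HasDerivWithinAt f₂ (f₃ x) (Icc α β) x)
    (hf₃ : ContinuousOn f₃ (Icc α β)) (hα : f α = 0) (hβ : f β = 0) (hβ' : f₁ β = 0) :
    ∫ x in α..β, 2 * f x * (f₃ x + a * f₁ x) = f₁ α ^ 2 := by
  have hf : ContinuousOn f (Icc α β) := fun x hx => (h₁ x hx).continuousWithinAt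
  have hf₁ : ContinuousOn f₁ (Icc α β) := fun x hx => (h₂ x hx).continuousWithinAt
  have hf₂ : ContinuousOn f₂ (Icc α β) := fun x hx => (h₃ x hx).continuousWithinAt
  have hprim : ∀ x ∈ Ioo α β, HasDerivAt (fun x => 2 * f x * f₂ x - f₁ x ^ 2 + a * f x ^ 2)
      (2 * f x * (f₃ x + a * f₁ x)) x := fun x hx => by
    have hx' := Ioo_subset_Icc_self hx
    have hn : Icc α β ∈ 𝓝 x := Icc_mem_nhds hx.1 hx.2
    have e₁ := (h₁ x hx').hasDerivAt hn
    refine ((((e₁.const_mul 2).mul ((h₃ x hx').hasDerivAt hn)).sub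
      (((h₂ x hx').hasDerivAt hn).pow 2)).add ((e₁.pow 2).const_mul a)).congr_deriv ?_
    push_cast
    ring
  rw [intervalIntegral.integral_eq_sub_of_hasDerivAt_of_le hαβ (by fun_prop) hprim
    (ContinuousOn.intervalIntegrable_of_Icc hαβ (by fun_prop)), hα, hβ, hβ']
  ring

/-- The energy `∫ y(x, t)² dx` of a function on `[-1, 0] × ℝ`. -/
noncomputable def energy (y : ℝ → ℝ → ℝ) (t : ℝ) : ℝ := ∫ x in (-1 : ℝ)..0, y x t ^ 2

namespace IsSolution

variable {a T : ℝ} {u v y₀ z₀ : ℝ → ℝ} {y z : ℝ → ℝ → ℝ}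

theorem hasDerivWithinAt_x (hy : IsSolution a T u y₀ y) {m : ℕ} (hm : m < 3) {t : ℝ}
    (ht : t ∈ Icc 0 T) {x : ℝ} (hx : x ∈ Icc (-1 : ℝ) 0) :
    HasDerivWithinAt (fun x => partialDeriv (Icc (-1) 0) (Icc 0 T) m 0 y x t)
      (partialDeriv (Icc (-1) 0) (Icc 0 T) (m + 1) 0 y x t) (Icc (-1) 0) x := by
  simp only [partialDeriv, iteratedDerivWithin_zero]
  rw [iteratedDerivWithin_succ]
  exact ((hy.contDiff_x t ht).differentiableOn_iteratedDerivWithin (by exact_mod_cast hm)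
    (uniqueDiffOn_Icc (by norm_num)) x hx).hasDerivWithinAt

theorem hasDerivWithinAt_t (hy : IsSolution a T u y₀ y) {t : ℝ}
    (ht : t ∈ Icc 0 T) {x : ℝ} (hx : x ∈ Icc (-1 : ℝ) 0) :
    HasDerivWithinAt (y x) (partialDeriv (Icc (-1) 0) (Icc 0 T) 0 1 y x t) (Icc 0 T) t := by
  simp only [partialDeriv, iteratedDerivWithin_zero, iteratedDerivWithin_one]
  exact ((hy.contDiff_t x hx).differentiableOn (by norm_num) t ht).hasDerivWithinAt

theorem partialDeriv_x_sub (hy : IsSolution a T u y₀ y) (hz : IsSolution a T v z₀ z) {m : ℕ}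
    (hm : m ≤ 3) {x t : ℝ} (hx : x ∈ Icc (-1 : ℝ) 0) (ht : t ∈ Icc 0 T) :
    partialDeriv (Icc (-1) 0) (Icc 0 T) m 0 (fun x t => y x t - z x t) x t =
      partialDeriv (Icc (-1) 0) (Icc 0 T) m 0 y x t
        - partialDeriv (Icc (-1) 0) (Icc 0 T) m 0 z x t := by
  have hm' : (m : ℕ∞ω) ≤ 3 := by exact_mod_cast hm
  simp only [partialDeriv, iteratedDerivWithin_zero]
  exact iteratedDerivWithin_sub hx (uniqueDiffOn_Icc (by norm_num))
    ((hy.contDiff_x t ht x hx).of_le hm') ((hz.contDiff_x t ht x hx).of_le hm')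

theorem partialDeriv_t_sub (hT : 0 < T) (hy : IsSolution a T u y₀ y) (hz : IsSolution a T v z₀ z)
    {x t : ℝ} (hx : x ∈ Icc (-1 : ℝ) 0) (ht : t ∈ Icc 0 T) :
    partialDeriv (Icc (-1) 0) (Icc 0 T) 0 1 (fun x t => y x t - z x t) x t =
      partialDeriv (Icc (-1) 0) (Icc 0 T) 0 1 y x t
        - partialDeriv (Icc (-1) 0) (Icc 0 T) 0 1 z x t := by
  simp only [partialDeriv, iteratedDerivWithin_zero]
  exact iteratedDerivWithin_sub ht (uniqueDiffOn_Icc hT) (hy.contDiff_t x hx t ht)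
    (hz.contDiff_t x hx t ht)

theorem sub (hT : 0 < T) (hy : IsSolution a T u y₀ y) (hz : IsSolution a T v z₀ z) :
    IsSolution a T (fun t => u t - v t) (fun x => y₀ x - z₀ x) (fun x t => y x t - z x t) where
  contDiff_x t ht := (hy.contDiff_x t ht).sub (hz.contDiff_x t ht)
  contDiff_t x hx := (hy.contDiff_t x hx).sub (hz.contDiff_t x hx)
  continuous_x m hm := ((hy.continuous_x m hm).sub (hz.continuous_x m hm)).congr
    fun _ hp => hy.partialDeriv_x_sub hz hm hp.1 hp.2
  continuous_t := (hy.continuous_t.sub hz.continuous_t).congr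
    fun _ hp => hy.partialDeriv_t_sub hT hz hp.1 hp.2
  equation x hx t ht := by
    have hx' := Ioo_subset_Icc_self hx
    have ht' := Ioo_subset_Icc_self ht
    rw [hy.partialDeriv_t_sub hT hz hx' ht', hy.partialDeriv_x_sub hz le_rfl hx' ht',
      hy.partialDeriv_x_sub hz (by norm_num) hx' ht']
    linear_combination hy.equation x hx t ht - hz.equation x hx t ht
  boundary_right t ht := by rw [hy.boundary_right t ht, hz.boundary_right t ht, sub_zero]
  boundary_right_deriv t ht := by
    rw [hy.partialDeriv_x_sub hz (by norm_num) (by norm_num) (Ioo_subset_Icc_self ht),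
      hy.boundary_right_deriv t ht, hz.boundary_right_deriv t ht, sub_zero]
  boundary_left t ht := by rw [hy.boundary_left t ht, hz.boundary_left t ht]
  initial x hx := by rw [hy.initial x hx, hz.initial x hx]

theorem continuousOn (hy : IsSolution a T u y₀ y) :
    ContinuousOn (fun p : ℝ × ℝ => y p.1 p.2) (Icc (-1) 0 ×ˢ Icc 0 T) := by
  simpa only [partialDeriv, iteratedDerivWithin_zero] using hy.continuous_x 0 (by norm_num)

theorem hasDerivAt_energy (hy : IsSolution a T (fun _ => 0) y₀ y) {t : ℝ} (ht : t ∈ Ioo 0 T) :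
    HasDerivAt (energy y) (-partialDeriv (Icc (-1) 0) (Icc 0 T) 1 0 y (-1) t ^ 2) t := by
  have ht' := Ioo_subset_Icc_self ht
  have hzero : ∀ x, partialDeriv (Icc (-1) 0) (Icc 0 T) 0 0 y x t = y x t := fun x => by
    simp only [partialDeriv, iteratedDerivWithin_zero]
  have hy₀ := hy.continuousOn
  have hyₜ := hy.continuous_t
  refine (hasDerivAt_intervalIntegral_of_prod (f := fun x t => y x t ^ 2)
    (f' := fun x t => 2 * y x t * partialDeriv (Icc (-1) 0) (Icc 0 T) 0 1 y x t)
    (by norm_num) (by fun_prop) (by fun_prop) (fun x hx s hs => ?_) ht).congr_deriv ?_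
  · simpa using ((hy.hasDerivWithinAt_t (Ioo_subset_Icc_self hs) hx).hasDerivAt
      (Icc_mem_nhds hs.1 hs.2)).fun_pow 2
  · rw [← integral_two_mul_mul_airy (a := a) (by norm_num)
        (fun x hx => hy.hasDerivWithinAt_x (m := 0) (by norm_num) ht' hx)
        (fun x hx => hy.hasDerivWithinAt_x (m := 1) (by norm_num) ht' hx)
        (fun x hx => hy.hasDerivWithinAt_x (m := 2) (by norm_num) ht' hx)
        (continuousOn_left_of_prod (hy.continuous_x 3 le_rfl) ht')
        (by rw [hzero, hy.boundary_left t ht]) (by rw [hzero, hy.boundary_right t ht])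
        (hy.boundary_right_deriv t ht), ← intervalIntegral.integral_neg]
    refine intervalIntegral_congr_Ioo (by norm_num) fun x hx => ?_
    simp only [hzero]
    linear_combination 2 * y x t * hy.equation x hx t ht

theorem antitoneOn_energy (hy : IsSolution a T (fun _ => 0) y₀ y) :
    AntitoneOn (energy y) (Icc 0 T) := by
  have hcont : ContinuousOn (energy y) (Icc 0 T) :=
    continuousOn_intervalIntegral_of_prod (by norm_num) isCompact_Icc (hy.continuousOn.pow 2)
  refine antitoneOn_of_deriv_nonpos (convex_Icc _ _) hcont ?_ ?_ <;> rw [interior_Icc]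
  · exact fun t ht => (hy.hasDerivAt_energy ht).differentiableAt.differentiableWithinAt
  · intro t ht
    rw [(hy.hasDerivAt_energy ht).deriv]
    exact neg_nonpos.2 (sq_nonneg _)

theorem eq_zero (hy : IsSolution a T (fun _ => 0) (fun _ => 0) y) {x t : ℝ}
    (hx : x ∈ Icc (-1 : ℝ) 0) (ht : t ∈ Icc 0 T) : y x t = 0 := by
  have hinitial : energy y 0 = 0 :=
    (intervalIntegral_congr_Ioo (by norm_num) fun x hx => by
      rw [hy.initial x hx]).trans (by norm_num : ∫ _ in (-1 : ℝ)..0, (0 : ℝ) ^ 2 = 0)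
  by_contra hne
  have hpos : 0 < energy y t := intervalIntegral.integral_pos (by norm_num)
    ((continuousOn_left_of_prod hy.continuousOn ht).pow 2) (fun _ _ => sq_nonneg _)
    ⟨x, hx, by positivity⟩
  exact hpos.not_ge (hinitial ▸ hy.antitoneOn_energy ⟨le_rfl, ht.1.trans ht.2⟩ ht ht.1)

theorem unique (hT : 0 < T) (hz : IsSolution a T u y₀ z) (hy : IsSolution a T u y₀ y) {x t : ℝ}
    (hx : x ∈ Icc (-1 : ℝ) 0) (ht : t ∈ Icc 0 T) : z x t = y x t := by
  have hdiff := hz.sub hT hy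
  simp only [sub_self] at hdiff
  exact sub_eq_zero.1 (hdiff.eq_zero hx ht)

end IsSolution

/-! ### Flows of `∂ₜY = P Y` -/

/-- `Y m n` is the partial derivative `∂ₓ^m ∂ₜ^n` of a solution `Y 0 0` of `∂ₜY = P Y` on
`[-1, 0] × S` with `Y = ∂ₓY = 0` at `x = 0`, and is Gevrey of order `1` in `x` and `3` in `t`.
Classical solutions of the control system are obtained from flows by reversing time. -/
structure IsFlow (a : ℝ) (S : Set ℝ) (Y : ℕ → ℕ → ℝ → ℝ → ℝ) : Prop where
  derivSeq_x : ∀ n, ∀ t ∈ S, IsDerivSeq (Icc (-1) 0) (fun m x => Y m n x t)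
  derivSeq_t : ∀ m, ∀ x ∈ Icc (-1 : ℝ) 0, IsDerivSeq S (fun n t => Y m n x t)
  equation : ∀ m n, ∀ x ∈ Icc (-1 : ℝ) 0, ∀ t ∈ S,
    Y (m + 3) n x t + a * Y (m + 1) n x t = Y m (n + 1) x t
  zero_right : ∀ n, ∀ t ∈ S, Y 0 n 0 t = 0
  zero_right_deriv : ∀ n, ∀ t ∈ S, Y 1 n 0 t = 0
  bound : ∃ C D : ℝ, 0 < C ∧ 0 < D ∧ ∀ m n, ∀ x ∈ Icc (-1 : ℝ) 0, ∀ t ∈ S,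
    |Y m n x t| ≤ C * D ^ (m + n) * (m.factorial * (n.factorial : ℝ) ^ 3)

theorem eq_of_recursion {a : ℝ} {f g : ℕ → ℕ → ℝ}
    (hf : ∀ m n, f (m + 3) n + a * f (m + 1) n = f m (n + 1))
    (hg : ∀ m n, g (m + 3) n + a * g (m + 1) n = g m (n + 1))
    (h0 : ∀ n, f 0 n = g 0 n) (h1 : ∀ n, f 1 n = g 1 n) (h2 : ∀ n, f 2 n = g 2 n) (m n : ℕ) :
    f m n = g m n := by
  induction m using Nat.strong_induction_on generalizing n with
  | _ m ih =>
    match m with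
    | 0 => exact h0 n
    | 1 => exact h1 n
    | 2 => exact h2 n
    | m + 3 =>
      linear_combination hf m n - hg m n + ih m (by omega) (n + 1) - a * ih (m + 1) (by omega) n

theorem sub_mem_Icc_of_mem {T t : ℝ} (ht : t ∈ Icc 0 T) : T - t ∈ Icc 0 T :=
  ⟨sub_nonneg.2 ht.2, sub_le_self T ht.1⟩

namespace IsFlow

variable {a : ℝ} {S : Set ℝ} {Y Z : ℕ → ℕ → ℝ → ℝ → ℝ}

theorem mono (hY : IsFlow a S Y) {S' : Set ℝ} (h : S' ⊆ S) : IsFlow a S' Y where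
  derivSeq_x n t ht := hY.derivSeq_x n t (h ht)
  derivSeq_t m x hx := (hY.derivSeq_t m x hx).mono h
  equation m n x hx t ht := hY.equation m n x hx t (h ht)
  zero_right n t ht := hY.zero_right n t (h ht)
  zero_right_deriv n t ht := hY.zero_right_deriv n t (h ht)
  bound :=
    let ⟨C, D, hC, hD, hb⟩ := hY.bound
    ⟨C, D, hC, hD, fun m n x hx t ht => hb m n x hx t (h ht)⟩

theorem sub (hY : IsFlow a S Y) (hZ : IsFlow a S Z) :
    IsFlow a S (fun m n x t => Y m n x t - Z m n x t) where
  derivSeq_x n t ht := (hY.derivSeq_x n t ht).sub (hZ.derivSeq_x n t ht)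
  derivSeq_t m x hx := (hY.derivSeq_t m x hx).sub (hZ.derivSeq_t m x hx)
  equation m n x hx t ht := by rw [← hY.equation m n x hx t ht, ← hZ.equation m n x hx t ht]; ring
  zero_right n t ht := by rw [hY.zero_right n t ht, hZ.zero_right n t ht, sub_zero]
  zero_right_deriv n t ht := by
    rw [hY.zero_right_deriv n t ht, hZ.zero_right_deriv n t ht, sub_zero]
  bound := by
    obtain ⟨C, D, hC, hD, hb⟩ := hY.bound
    obtain ⟨C', D', hC', hD', hb'⟩ := hZ.bound
    refine ⟨C + C', max D D', by positivity, by positivity, fun m n x hx t ht => ?_⟩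
    calc |Y m n x t - Z m n x t| ≤ C * D ^ (m + n) * (m.factorial * (n.factorial : ℝ) ^ 3)
          + C' * D' ^ (m + n) * (m.factorial * (n.factorial : ℝ) ^ 3) :=
        (abs_sub _ _).trans (add_le_add (hb m n x hx t ht) (hb' m n x hx t ht))
      _ = (C * D ^ (m + n) + C' * D' ^ (m + n)) * (m.factorial * (n.factorial : ℝ) ^ 3) := by ring
      _ ≤ _ := by gcongr; exact mul_pow_add_mul_pow_le hC.le hD.le hC'.le hD'.le _

variable {T : ℝ}

theorem isPartialFamily_reverse (hY : IsFlow a (Icc 0 T) Y) :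
    IsPartialFamily (Icc (-1) 0) (Icc 0 T) (fun m n x t => (-1) ^ n * Y m n x (T - t)) where
  derivSeq_x n t ht m x hx :=
    (hY.derivSeq_x n (T - t) (sub_mem_Icc_of_mem ht) m x hx).const_mul _
  derivSeq_t m x hx := by
    simpa [sub_eq_add_neg] using (hY.derivSeq_t m x hx).comp_affine (b := T) (c := -1)
      (fun t ht => by simpa [sub_eq_add_neg] using sub_mem_Icc_of_mem ht)
  bounded m n := by
    obtain ⟨C, D, -, -, hb⟩ := hY.bound
    refine ⟨C * D ^ (m + n) * (m.factorial * (n.factorial : ℝ) ^ 3), fun x hx t ht => ?_⟩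
    simpa [abs_mul] using hb m n x hx (T - t) (sub_mem_Icc_of_mem ht)

theorem partialDeriv_reverse (hT : 0 < T) (hY : IsFlow a (Icc 0 T) Y) (m n : ℕ) {x t : ℝ}
    (hx : x ∈ Icc (-1 : ℝ) 0) (ht : t ∈ Icc 0 T) :
    partialDeriv (Icc (-1) 0) (Icc 0 T) m n (fun x t => Y 0 0 x (T - t)) x t
      = (-1) ^ n * Y m n x (T - t) := by
  simpa using hY.isPartialFamily_reverse.partialDeriv_eq (uniqueDiffOn_Icc (by norm_num))
    (uniqueDiffOn_Icc hT) m n hx ht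

theorem gevreyRect (hT : 0 < T) (hY : IsFlow a (Icc 0 T) Y) :
    GevreyRect 1 3 (-1) 0 0 T (fun x t => Y 0 0 x (T - t)) := by
  have hsmooth := hY.isPartialFamily_reverse.contDiffOn (convex_Icc _ _) (convex_Icc _ _)
    (uniqueDiffOn_Icc (by norm_num)) (uniqueDiffOn_Icc hT) 0 0
  refine ⟨by simpa using hsmooth, ?_⟩
  obtain ⟨C, D, hC, hD, hb⟩ := hY.bound
  refine ⟨C, D⁻¹, D⁻¹, hC, by positivity, by positivity, fun m n x hx t ht => ?_⟩
  calc |partialDeriv (Icc (-1) 0) (Icc 0 T) m n (fun x t => Y 0 0 x (T - t)) x t|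
      = |Y m n x (T - t)| := by rw [hY.partialDeriv_reverse hT m n hx ht]; simp [abs_mul]
    _ ≤ C * D ^ (m + n) * (m.factorial * (n.factorial : ℝ) ^ 3) :=
      hb m n x hx _ (sub_mem_Icc_of_mem ht)
    _ = C * ((m.factorial : ℝ) ^ (1 : ℝ) * (n.factorial : ℝ) ^ (3 : ℝ)) / (D⁻¹ ^ m * D⁻¹ ^ n) := by
      rw [Real.rpow_one, show (3 : ℝ) = ((3 : ℕ) : ℝ) by norm_num, Real.rpow_natCast, ← pow_add,
        inv_pow, div_inv_eq_mul]
      ring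

theorem gevrey_left (hT : 0 < T) (hY : IsFlow a (Icc 0 T) Y) :
    Gevrey 3 0 T (fun t => Y 0 0 (-1) (T - t)) := by
  obtain ⟨hsmooth, C, R₁, R₂, hC, -, hR₂, hb⟩ := hY.gevreyRect hT
  have hm : (-1 : ℝ) ∈ Icc (-1 : ℝ) 0 := by norm_num
  refine ⟨hsmooth.comp (f := fun t : ℝ => ((-1 : ℝ), t)) (by fun_prop) fun t ht => ⟨hm, ht⟩,
    C, R₂, hC, hR₂, fun n t ht => ?_⟩
  simpa [partialDeriv] using hb 0 n (-1) hm t ht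

theorem isSolution (hT : 0 < T) (hY : IsFlow a (Icc 0 T) Y)
    (h0 : ∀ x ∈ Icc (-1 : ℝ) 0, Y 0 0 x T = 0) :
    IsSolution a T (fun t => Y 0 0 (-1) (T - t)) (fun _ => 0) (fun x t => Y 0 0 x (T - t)) := by
  have hsmooth := (hY.gevreyRect hT).1
  have hcont (m n : ℕ) : ContinuousOn (fun p : ℝ × ℝ => partialDeriv (Icc (-1) 0) (Icc 0 T) m n
      (fun x t => Y 0 0 x (T - t)) p.1 p.2) (Icc (-1) 0 ×ˢ Icc 0 T) :=
    (hY.isPartialFamily_reverse.continuousOn (convex_Icc _ _) (convex_Icc _ _) m n).congr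
      fun p hp => hY.partialDeriv_reverse hT m n hp.1 hp.2
  exact
    { contDiff_x t ht := contDiffOn_infty.1
        (hsmooth.comp (f := fun x : ℝ => (x, t)) (by fun_prop) fun x hx => ⟨hx, ht⟩) 3
      contDiff_t x hx := mod_cast contDiffOn_infty.1
        (hsmooth.comp (f := fun t : ℝ => (x, t)) (by fun_prop) fun t ht => ⟨hx, ht⟩) 1
      continuous_x m _ := hcont m 0
      continuous_t := hcont 0 1
      equation x hx t ht := by
        have hx' := Ioo_subset_Icc_self hx
        have ht' := Ioo_subset_Icc_self ht
        simp only [hY.partialDeriv_reverse hT _ _ hx' ht']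
        linear_combination hY.equation 0 0 x hx' (T - t) (sub_mem_Icc_of_mem ht')
      boundary_right t ht := hY.zero_right 0 _ (sub_mem_Icc_of_mem (Ioo_subset_Icc_self ht))
      boundary_right_deriv t ht := by
        have ht' := Ioo_subset_Icc_self ht
        rw [hY.partialDeriv_reverse hT _ _ (by norm_num) ht',
          hY.zero_right_deriv 0 _ (sub_mem_Icc_of_mem ht'), mul_zero]
      boundary_left _ _ := rfl
      initial x hx := by simpa using h0 x (Ioo_subset_Icc_self hx) }

theorem eqOn_of_recursion (hY : IsFlow a S Y) {t : ℝ} (ht : t ∈ S) {f : ℕ → ℕ → ℝ → ℝ}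
    (hf : IsDerivSeq (Icc (-1) 0) (fun m => f m 0)) {C D : ℝ} (hC : 0 ≤ C) (hD : 0 ≤ D)
    (hb : ∀ m, ∀ x ∈ Icc (-1 : ℝ) 0, |f m 0 x| ≤ C * D ^ m * m.factorial)
    (hrec : ∀ m n, f (m + 3) n 0 + a * f (m + 1) n 0 = f m (n + 1) 0) (h0 : ∀ n, f 0 n 0 = 0)
    (h1 : ∀ n, f 1 n 0 = 0) (h2 : ∀ n, Y 2 n 0 t = f 2 n 0) :
    EqOn (fun x => Y 0 0 x t) (f 0 0) (Icc (-1) 0) := by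
  obtain ⟨C', D', hC', hD', hb'⟩ := hY.bound
  have hmem : (0 : ℝ) ∈ Icc (-1 : ℝ) 0 := by norm_num
  exact (hY.derivSeq_x 0 t ht).eqOn_of_analytic_bound (g := fun m => f m 0) hf
    (convex_Icc _ _) hC'.le hD'.le hC hD
    (fun m x hx => by simpa using hb' m 0 x hx t ht) hb hmem fun m =>
      eq_of_recursion (f := fun m n => Y m n 0 t) (g := fun m n => f m n 0)
        (fun m n => hY.equation m n 0 hmem t ht) hrec
        (fun n => by rw [hY.zero_right n t ht, h0])
        (fun n => by rw [hY.zero_right_deriv n t ht, h1]) h2 m 0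

theorem eqOn_of_trace_eq (hY : IsFlow a S Y) (hZ : IsFlow a S Z) {t : ℝ} (ht : t ∈ S)
    (htrace : ∀ n, Y 2 n 0 t = Z 2 n 0 t) :
    EqOn (fun x => Y 0 0 x t) (fun x => Z 0 0 x t) (Icc (-1) 0) := by
  obtain ⟨C, D, hC, hD, hb⟩ := hZ.bound
  exact hY.eqOn_of_recursion ht (f := fun m n x => Z m n x t) (hZ.derivSeq_x 0 t ht) hC.le hD.le
    (fun m x hx => by simpa using hb m 0 x hx t ht)
    (fun m n => hZ.equation m n 0 (by norm_num) t ht) (fun n => hZ.zero_right n t ht)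
    (fun n => hZ.zero_right_deriv n t ht) htrace

end IsFlow

/-! ### Exponential generating series -/

section ExpSeries

variable {E : Type*} [NormedAddCommGroup E] [NormedSpace ℝ E] {c : ℕ → E} {r x : ℝ}

/-- The exponential generating function of the sequence `c`, i.e. the function with Taylor
coefficients `c k` at `0`. -/
noncomputable def expSeries (c : ℕ → E) (x : ℝ) : E := ∑' k : ℕ, (x ^ k / k.factorial) • c k

theorem expSeries_zero (c : ℕ → E) : expSeries c 0 = c 0 := by
  rw [expSeries, tsum_eq_single 0 fun k hk => by simp [hk]]
  simp

theorem norm_expSeries_term_le (c : ℕ → E) (hx : |x| ≤ r) (k : ℕ) :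
    ‖(x ^ k / k.factorial) • c k‖ ≤ r ^ k / k.factorial * ‖c k‖ := by
  rw [norm_smul, Real.norm_eq_abs, abs_div, abs_pow, Nat.abs_cast]
  gcongr

theorem norm_expSeries_le (hc : Summable fun k : ℕ => r ^ k / k.factorial * ‖c k‖)
    (hx : |x| ≤ r) : ‖expSeries c x‖ ≤ ∑' k : ℕ, r ^ k / k.factorial * ‖c k‖ :=
  tsum_of_norm_bounded hc.hasSum (norm_expSeries_term_le c hx)

variable [CompleteSpace E]

theorem summable_expSeries (hc : Summable fun k : ℕ => r ^ k / k.factorial * ‖c k‖)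
    (hx : |x| ≤ r) : Summable fun k : ℕ => (x ^ k / k.factorial) • c k :=
  Summable.of_norm_bounded hc (norm_expSeries_term_le c hx)

theorem hasDerivAt_expSeries (hc : Summable fun k : ℕ => r ^ k / k.factorial * ‖c k‖)
    (hc' : Summable fun k : ℕ => r ^ k / k.factorial * ‖c (k + 1)‖) (hx : |x| < r) :
    HasDerivAt (expSeries c) (expSeries (fun k => c (k + 1)) x) x := by
  have hball {y : ℝ} (hy : y ∈ Metric.ball (0 : ℝ) r) : |y| ≤ r := (mem_ball_zero_iff.1 hy).le
  have hterm (k : ℕ) (y : ℝ) :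
      HasDerivAt (fun y : ℝ => (y ^ (k + 1) / (k + 1).factorial) • c (k + 1))
        ((y ^ k / k.factorial) • c (k + 1)) y := by
    refine (((hasDerivAt_pow (k + 1) y).div_const ((k + 1).factorial : ℝ)).smul_const
      (c (k + 1))).congr_deriv ?_
    congr 1
    rw [Nat.factorial_succ]
    push_cast
    field_simp
  have htail := hasDerivAt_tsum_of_isPreconnected (y₀ := (0 : ℝ)) (y := x) hc' Metric.isOpen_ball
    (convex_ball (0 : ℝ) r).isPreconnected (fun k y _ => hterm k y)
    (fun k y hy => norm_expSeries_term_le (fun k => c (k + 1)) (hball hy) k)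
    (Metric.mem_ball_self ((abs_nonneg x).trans_lt hx)) (by simp) (by simpa using hx)
  refine (htail.const_add (c 0)).congr_of_eventuallyEq ?_
  filter_upwards [Metric.isOpen_ball.mem_nhds (mem_ball_zero_iff.2 hx)] with y hy
  rw [expSeries, (summable_expSeries hc (hball hy)).tsum_eq_zero_add]
  simp

end ExpSeries

/-! ### The Cauchy problem in `x` -/

section TaylorCoeff

variable {E : Type*} [NormedAddCommGroup E] [NormedSpace ℝ E] {a : ℝ} {w : ℕ → E}

/-- The values at `x = 0` of `∂ₓ^m ∂ₜ^n Y`, where `∂ₜY = P Y`, `Y = ∂ₓY = 0` at `x = 0` and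
`∂ₓ²∂ₜ^n Y = w n` at `x = 0`. -/
def taylorCoeff (a : ℝ) (w : ℕ → E) : ℕ → ℕ → E
  | 0, _ => 0
  | 1, _ => 0
  | 2, n => w n
  | m + 3, n => taylorCoeff a w m (n + 1) - a • taylorCoeff a w (m + 1) n

theorem taylorCoeff_add_three (m n : ℕ) : taylorCoeff a w (m + 3) n
    = taylorCoeff a w m (n + 1) - a • taylorCoeff a w (m + 1) n := rfl

theorem norm_taylorCoeff_le {W : ℕ → ℝ} (hW : Monotone W) (hw : ∀ n, ‖w n‖ ≤ W n) (m n : ℕ) :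
    ‖taylorCoeff a w m n‖ ≤ (1 + |a|) ^ m * W (n + m / 3) := by
  have hW0 (n : ℕ) : 0 ≤ W n := (norm_nonneg _).trans (hw n)
  induction m using Nat.strong_induction_on generalizing n with
  | _ m ih =>
    match m with
    | 0 => simpa [taylorCoeff] using hW0 n
    | 1 => simpa [taylorCoeff] using mul_nonneg (by positivity) (hW0 n)
    | 2 => exact (hw n).trans (le_mul_of_one_le_left (hW0 n) (one_le_pow₀ (by simp)))
    | m + 3 =>
      have hstep₀ : ‖taylorCoeff a w m (n + 1)‖ ≤ (1 + |a|) ^ m * W (n + (m + 3) / 3) := by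
        simpa [show n + 1 + m / 3 = n + (m + 3) / 3 by omega] using ih m (by omega) (n + 1)
      have hstep₁ : ‖taylorCoeff a w (m + 1) n‖ ≤ (1 + |a|) ^ (m + 1) * W (n + (m + 3) / 3) :=
        (ih (m + 1) (by omega) n).trans (by gcongr; exact hW (by omega))
      calc ‖taylorCoeff a w (m + 3) n‖
          ≤ ‖taylorCoeff a w m (n + 1)‖ + |a| * ‖taylorCoeff a w (m + 1) n‖ := by
            simpa [taylorCoeff_add_three, norm_smul] using
              norm_sub_le (taylorCoeff a w m (n + 1)) (a • taylorCoeff a w (m + 1) n)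
        _ ≤ (1 + |a|) ^ m * W (n + (m + 3) / 3)
            + |a| * ((1 + |a|) ^ (m + 1) * W (n + (m + 3) / 3)) := by gcongr
        _ = (1 + |a| * (1 + |a|)) * ((1 + |a|) ^ m * W (n + (m + 3) / 3)) := by ring
        _ ≤ (1 + |a|) ^ 3 * ((1 + |a|) ^ m * W (n + (m + 3) / 3)) := by
          have := hW0 (n + (m + 3) / 3)
          have := abs_nonneg a
          gcongr
          nlinarith [pow_nonneg this 2, pow_nonneg this 3]
        _ = (1 + |a|) ^ (m + 3) * W (n + (m + 3) / 3) := by ring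

theorem taylorCoeff_eq_zero (hw : ∀ n, w n = 0) (m n : ℕ) : taylorCoeff a w m n = 0 := by
  fun_induction taylorCoeff a w m n <;> simp_all

theorem IsDerivSeq.taylorCoeff {S : Set ℝ} {w : ℕ → ℝ → E} (hw : IsDerivSeq S w)
    (m : ℕ) : IsDerivSeq S fun n t => taylorCoeff a (fun n => w n t) m n := by
  intro n t ht
  induction m using Nat.strong_induction_on generalizing n with
  | _ m ih =>
    match m with
    | 0 => exact hasDerivWithinAt_const t S 0
    | 1 => exact hasDerivWithinAt_const t S 0
    | 2 => exact hw n t ht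
    | m + 3 => exact (ih m (by omega) (n + 1)).sub ((ih (m + 1) (by omega) n).const_smul a)

theorem summable_pow_div_factorial_div_three {D : ℝ} (hD : 0 ≤ D) :
    Summable fun k : ℕ => D ^ k / (k / 3).factorial := by
  have hprod : Summable fun p : ℕ × Fin 3 => (D ^ 3) ^ p.1 / p.1.factorial * D ^ (p.2 : ℕ) :=
    (Real.summable_pow_div_factorial (D ^ 3)).mul_of_nonneg
      (g := fun i : Fin 3 => D ^ (i : ℕ)) (Summable.of_finite) (fun _ => by positivity)
      fun _ => by positivity
  refine ((Nat.divModEquiv 3).summable_iff.2 hprod).congr fun k => ?_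
  rw [Function.comp_apply, div_mul_eq_mul_div, ← pow_mul, ← pow_add]
  congr 2
  exact Nat.div_add_mod k 3

theorem factorial_add_div_three_sq_div_le (k m : ℕ) :
    (((k + m) / 3).factorial : ℝ) ^ 2 / k.factorial
      ≤ 2 ^ (k + m) * m.factorial / (k / 3).factorial := by
  have hmono : ((k / 3).factorial : ℝ) ≤ ((k + m) / 3).factorial := mod_cast
    Nat.factorial_le (by omega)
  rw [div_le_div_iff₀ (by positivity) (by positivity)]
  calc (((k + m) / 3).factorial : ℝ) ^ 2 * (k / 3).factorial
      ≤ (((k + m) / 3).factorial : ℝ) ^ 2 * ((k + m) / 3).factorial := by gcongr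
    _ = (((k + m) / 3).factorial : ℝ) ^ 3 := by ring
    _ ≤ (3 * ((k + m) / 3)).factorial := factorial_pow_three_le _
    _ ≤ (k + m).factorial := mod_cast Nat.factorial_le (by omega)
    _ ≤ 2 ^ (k + m) * (k.factorial * m.factorial) := factorial_add_le k m
    _ = 2 ^ (k + m) * m.factorial * k.factorial := by ring

end TaylorCoeff

section TaylorFlow

variable {E : Type*} [NormedAddCommGroup E] [NormedSpace ℝ E] {a K L x : ℝ} {w : ℕ → E}

/-- The derivatives `∂ₓ^m ∂ₜ^n Y` at `(x, t)` of the solution of the Cauchy problem `∂ₜY = P Y`,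
`Y = ∂ₓY = 0` and `∂ₓ²∂ₜ^n Y = w n` at `(0, t)`. -/
noncomputable def taylorFlow (a : ℝ) (w : ℕ → E) (m n : ℕ) (x : ℝ) : E :=
  expSeries (fun k => taylorCoeff a w (k + m) n) x

theorem taylorFlow_zero_right (m n : ℕ) : taylorFlow a w m n 0 = taylorCoeff a w m n := by
  rw [taylorFlow, expSeries_zero, zero_add]

theorem taylorFlow_eq_zero (hw : ∀ n, w n = 0) (m n : ℕ) : taylorFlow a w m n x = 0 := by
  simp [taylorFlow, expSeries, taylorCoeff_eq_zero hw]

theorem two_pow_div_factorial_mul_norm_taylorCoeff_le (hL : 1 ≤ L)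
    (hw : ∀ n, ‖w n‖ ≤ K * L ^ n * (n.factorial : ℝ) ^ 2) (m n k : ℕ) :
    2 ^ k / k.factorial * ‖taylorCoeff a w (k + m) n‖
      ≤ K * (16 * L * (1 + |a|)) ^ (m + n) * (m.factorial * (n.factorial : ℝ) ^ 2)
        * ((16 * L * (1 + |a|)) ^ k / (k / 3).factorial) := by
  have hK : 0 ≤ K := by simpa using (norm_nonneg _).trans (hw 0)
  have hW : Monotone fun n : ℕ => K * L ^ n * (n.factorial : ℝ) ^ 2 := fun i j hij => by
    dsimp only; gcongr
  set j := (k + m) / 3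
  calc 2 ^ k / k.factorial * ‖taylorCoeff a w (k + m) n‖
      ≤ 2 ^ k / k.factorial * ((1 + |a|) ^ (k + m) * (K * L ^ (n + j)
        * (2 ^ (n + j) * (n.factorial * j.factorial)) ^ 2)) := by
        gcongr
        refine (norm_taylorCoeff_le hW hw (k + m) n).trans ?_
        gcongr
        exact factorial_add_le n j
    _ = K * (1 + |a|) ^ (k + m) * (4 * L) ^ (n + j) * 2 ^ k * (n.factorial : ℝ) ^ 2
        * ((j.factorial : ℝ) ^ 2 / k.factorial) := by
        rw [mul_pow 4 L, show (4 : ℝ) = 2 ^ 2 by norm_num, pow_right_comm]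
        ring
    _ ≤ K * (1 + |a|) ^ (k + m) * (4 * L) ^ (n + (k + m)) * 2 ^ (k + m) * (n.factorial : ℝ) ^ 2
        * (2 ^ (k + m) * m.factorial / (k / 3).factorial) := by
        gcongr ?_ * ?_
        · gcongr
          · linarith
          · omega
          · norm_num
          · omega
        · exact factorial_add_div_three_sq_div_le k m
    _ = K * (16 * L * (1 + |a|)) ^ (k + m) * (4 * L) ^ n
        * (m.factorial * (n.factorial : ℝ) ^ 2) / (k / 3).factorial := by
        rw [show 16 * L * (1 + |a|) = (1 + |a|) * (4 * L) * 2 * 2 by ring, mul_pow _ (2 : ℝ),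
          mul_pow _ (2 : ℝ), mul_pow (1 + |a|)]
        ring
    _ ≤ K * (16 * L * (1 + |a|)) ^ (k + m) * (16 * L * (1 + |a|)) ^ n
        * (m.factorial * (n.factorial : ℝ) ^ 2) / (k / 3).factorial := by
        gcongr _ * ?_ ^ n * _ / _
        nlinarith [mul_nonneg (by linarith : 0 ≤ L) (abs_nonneg a)]
    _ = _ := by ring

theorem summable_taylorFlow (hL : 1 ≤ L)
    (hw : ∀ n, ‖w n‖ ≤ K * L ^ n * (n.factorial : ℝ) ^ 2) (m n : ℕ) :
    Summable fun k : ℕ => 2 ^ k / k.factorial * ‖taylorCoeff a w (k + m) n‖ :=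
  .of_nonneg_of_le (fun _ => by positivity)
    (two_pow_div_factorial_mul_norm_taylorCoeff_le hL hw m n)
    ((summable_pow_div_factorial_div_three (by positivity)).mul_left _)

theorem norm_taylorFlow_le (hL : 1 ≤ L) (hw : ∀ n, ‖w n‖ ≤ K * L ^ n * (n.factorial : ℝ) ^ 2)
    (hx : |x| ≤ 2) (m n : ℕ) :
    ‖taylorFlow a w m n x‖ ≤ K * (∑' k : ℕ, (16 * L * (1 + |a|)) ^ k / (k / 3).factorial)
      * (16 * L * (1 + |a|)) ^ (m + n) * (m.factorial * (n.factorial : ℝ) ^ 2) := by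
  refine (norm_expSeries_le (summable_taylorFlow hL hw m n) hx).trans ?_
  refine ((summable_taylorFlow hL hw m n).tsum_le_tsum
    (two_pow_div_factorial_mul_norm_taylorCoeff_le hL hw m n)
    ((summable_pow_div_factorial_div_three (by positivity)).mul_left _)).trans_eq ?_
  rw [tsum_mul_left]
  ring

variable [CompleteSpace E]

theorem hasDerivAt_taylorFlow (hL : 1 ≤ L)
    (hw : ∀ n, ‖w n‖ ≤ K * L ^ n * (n.factorial : ℝ) ^ 2) (hx : |x| < 2) (m n : ℕ) :
    HasDerivAt (taylorFlow a w m n) (taylorFlow a w (m + 1) n x) x := by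
  have hshift (k : ℕ) : k + (m + 1) = k + 1 + m := by ring
  have hsum := summable_taylorFlow (a := a) hL hw (m + 1) n
  simp only [taylorFlow, hshift] at hsum ⊢
  exact hasDerivAt_expSeries (summable_taylorFlow hL hw m n) hsum hx

theorem taylorFlow_add_three (hL : 1 ≤ L)
    (hw : ∀ n, ‖w n‖ ≤ K * L ^ n * (n.factorial : ℝ) ^ 2) (hx : |x| ≤ 2) (m n : ℕ) :
    taylorFlow a w (m + 3) n x = taylorFlow a w m (n + 1) x - a • taylorFlow a w (m + 1) n x := by
  have hsum (m n : ℕ) := summable_expSeries (summable_taylorFlow (a := a) hL hw m n) hx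
  rw [taylorFlow, taylorFlow, taylorFlow, expSeries, expSeries, expSeries,
    ← (hsum (m + 1) n).tsum_const_smul, ← (hsum m (n + 1)).tsum_sub ((hsum (m + 1) n).const_smul a)]
  refine tsum_congr fun k => ?_
  rw [← add_assoc k m 3, taylorCoeff_add_three, smul_sub, smul_comm, add_assoc k m 1]

theorem hasDerivAt_taylorFlow_param {w : ℕ → ℝ → E} (hw : IsDerivSeq univ w) (hL : 1 ≤ L)
    (hb : ∀ n t, ‖w n t‖ ≤ K * L ^ n * (n.factorial : ℝ) ^ 2) (hx : |x| ≤ 2) (m n : ℕ) (t : ℝ) :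
    HasDerivAt (fun t => taylorFlow a (fun n => w n t) m n x)
      (taylorFlow a (fun n => w n t) m (n + 1) x) t :=
  hasDerivAt_tsum
    (u := fun k => K * (16 * L * (1 + |a|)) ^ (m + (n + 1))
      * (m.factorial * ((n + 1).factorial : ℝ) ^ 2)
      * ((16 * L * (1 + |a|)) ^ k / (k / 3).factorial))
    (g := fun k t => (x ^ k / k.factorial) • taylorCoeff a (fun n => w n t) (k + m) n)
    (g' := fun k t => (x ^ k / k.factorial) • taylorCoeff a (fun n => w n t) (k + m) (n + 1))
    ((summable_pow_div_factorial_div_three (by positivity)).mul_left _)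
    (fun k t => ((hw.taylorCoeff (k + m) n t (mem_univ t)).hasDerivAt univ_mem).fun_const_smul _)
    (fun k t => (norm_expSeries_term_le (fun k => taylorCoeff a (fun n => w n t) (k + m) (n + 1))
      hx k).trans (two_pow_div_factorial_mul_norm_taylorCoeff_le hL (fun n => hb n t) m (n + 1) k))
    (summable_expSeries (summable_taylorFlow hL (fun n => hb n t) m n) hx) t

theorem abs_lt_two_of_mem {x : ℝ} (hx : x ∈ Icc (-1 : ℝ) 0) : |x| < 2 :=
  abs_lt.2 ⟨by linarith [hx.1], by linarith [hx.2]⟩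

theorem isFlow_taylorFlow {w : ℕ → ℝ → ℝ} (hw : IsDerivSeq univ w) (hL : 1 ≤ L)
    (hb : ∀ n t, |w n t| ≤ K * L ^ n * (n.factorial : ℝ) ^ 2) :
    IsFlow a univ (fun m n x t => taylorFlow a (fun n => w n t) m n x) where
  derivSeq_x n t _ m x hx :=
    (hasDerivAt_taylorFlow hL (fun n => hb n t) (abs_lt_two_of_mem hx) m n).hasDerivWithinAt
  derivSeq_t m x hx n t _ :=
    (hasDerivAt_taylorFlow_param hw hL hb (abs_lt_two_of_mem hx).le m n t).hasDerivWithinAt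
  equation m n x hx t _ := by
    rw [taylorFlow_add_three (w := fun n => w n t) hL (fun n => hb n t) (abs_lt_two_of_mem hx).le,
      smul_eq_mul, sub_add_cancel]
  zero_right n t _ := taylorFlow_zero_right 0 n
  zero_right_deriv n t _ := taylorFlow_zero_right 1 n
  bound := by
    have hK : 0 ≤ K := by simpa using (abs_nonneg _).trans (hb 0 0)
    set D := 16 * L * (1 + |a|)
    have : 0 ≤ ∑' k : ℕ, D ^ k / (k / 3).factorial := tsum_nonneg fun _ => by positivity
    refine ⟨K * (∑' k : ℕ, D ^ k / (k / 3).factorial) + 1, D, by positivity, by positivity,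
      fun m n x hx t _ => ?_⟩
    refine (norm_taylorFlow_le (w := fun n => w n t) hL (fun n => hb n t)
      (abs_lt_two_of_mem hx).le m n).trans ?_
    gcongr
    · linarith
    · exact Nat.one_le_cast.2 n.factorial_pos
    · norm_num

end TaylorFlow

/-! ### Eigenfunctions of `P` -/

/-- The derivatives `∂ₓ^m G(x, l)` of the solution of `P G = l G` with `G = ∂ₓG = 0` and `∂ₓ²G = 1`
at `x = 0`. -/
noncomputable def eigenfun (a : ℝ) (l : ℂ) (m : ℕ) (x : ℝ) : ℂ :=
  taylorFlow a (fun n => l ^ n) m 0 x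

section Eigenfun

variable {a x : ℝ} {l : ℂ}

theorem norm_pow_le_mul_factorial_sq (l : ℂ) (n : ℕ) :
    ‖l ^ n‖ ≤ 1 * (1 + ‖l‖) ^ n * (n.factorial : ℝ) ^ 2 := by
  rw [norm_pow, one_mul]
  refine (pow_le_pow_left₀ (norm_nonneg l) (by linarith) n).trans
    (le_mul_of_one_le_right (by positivity) (one_le_pow₀ (Nat.one_le_cast.2 n.factorial_pos)))

theorem taylorCoeff_pow_succ (m n : ℕ) : taylorCoeff a (fun n => l ^ n) m (n + 1)
    = l * taylorCoeff a (fun n => l ^ n) m n := by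
  induction m using Nat.strong_induction_on generalizing n with
  | _ m ih =>
    match m with
    | 0 => simp [taylorCoeff]
    | 1 => simp [taylorCoeff]
    | 2 => exact pow_succ' l n
    | m + 3 =>
      rw [taylorCoeff_add_three, taylorCoeff_add_three, ih m (by omega) (n + 1),
        ih (m + 1) (by omega), mul_sub, mul_smul_comm]

theorem taylorFlow_pow_succ (m n : ℕ) (x : ℝ) : taylorFlow a (fun n => l ^ n) m (n + 1) x
    = l * taylorFlow a (fun n => l ^ n) m n x := by
  simp only [taylorFlow, expSeries, taylorCoeff_pow_succ, ← tsum_mul_left, mul_smul_comm]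

theorem eigenfun_add_three (hx : |x| ≤ 2) (m : ℕ) :
    eigenfun a l (m + 3) x = l * eigenfun a l m x - a * eigenfun a l (m + 1) x := by
  rw [eigenfun, taylorFlow_add_three (by simp) (norm_pow_le_mul_factorial_sq l) hx,
    taylorFlow_pow_succ, Complex.real_smul, eigenfun, eigenfun]

theorem hasDerivAt_eigenfun (hx : |x| < 2) (m : ℕ) :
    HasDerivAt (eigenfun a l m) (eigenfun a l (m + 1) x) x :=
  hasDerivAt_taylorFlow (by simp) (norm_pow_le_mul_factorial_sq l) hx m 0

theorem eigenfun_zero_right : eigenfun a l 0 0 = 0 := taylorFlow_zero_right 0 0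

theorem eigenfun_one_zero_right : eigenfun a l 1 0 = 0 := taylorFlow_zero_right 1 0

theorem eigenfun_two_zero_right : eigenfun a l 2 0 = 1 :=
  (taylorFlow_zero_right 2 0).trans (pow_zero l)

theorem measurable_taylorCoeff_pow (m n : ℕ) :
    Measurable fun l : ℂ => taylorCoeff a (fun n => l ^ n) m n := by
  induction m using Nat.strong_induction_on generalizing n with
  | _ m ih =>
    match m with
    | 0 => exact measurable_const
    | 1 => exact measurable_const
    | 2 => exact measurable_id.pow_const n
    | m + 3 => exact (ih m (by omega) (n + 1)).sub ((ih (m + 1) (by omega) n).const_smul a)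

theorem measurable_eigenfun (hx : |x| ≤ 2) (m : ℕ) : Measurable fun l => eigenfun a l m x := by
  refine measurable_of_tendsto_metrizable (f := fun N l => ∑ k ∈ Finset.range N,
    (x ^ k / k.factorial) • taylorCoeff a (fun n => l ^ n) (k + m) 0)
    (fun N => Finset.measurable_fun_sum _ fun k _ =>
      (measurable_taylorCoeff_pow (k + m) 0).const_smul (x ^ k / k.factorial : ℝ)) ?_
  exact tendsto_pi_nhds.2 fun l => (summable_expSeries
    (summable_taylorFlow (by simp) (norm_pow_le_mul_factorial_sq l) m 0) hx).hasSum.tendsto_sum_nat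

theorem norm_eigenfun_le_pow {q Q : ℝ} (hx : |x| ≤ 2) (hq : 1 ≤ q) (hq3 : ‖l‖ + |a| * q ≤ q ^ 3)
    (hQ : ∀ k ≤ 2, ‖eigenfun a l k x‖ ≤ Q) (m : ℕ) : ‖eigenfun a l m x‖ ≤ q ^ m * Q := by
  have hQ0 : 0 ≤ Q := (norm_nonneg _).trans (hQ 0 (by norm_num))
  have : 0 ≤ q := by linarith
  induction m using Nat.strong_induction_on with
  | _ m ih =>
    by_cases hm : m ≤ 2
    · exact (hQ m hm).trans (le_mul_of_one_le_left hQ0 (one_le_pow₀ hq))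
    obtain ⟨m, rfl⟩ : ∃ j, m = j + 3 := ⟨m - 3, by omega⟩
    calc ‖eigenfun a l (m + 3) x‖
        ≤ ‖l‖ * ‖eigenfun a l m x‖ + |a| * ‖eigenfun a l (m + 1) x‖ := by
          simpa [eigenfun_add_three hx] using
            norm_sub_le (l * eigenfun a l m x) (a * eigenfun a l (m + 1) x)
      _ ≤ ‖l‖ * (q ^ m * Q) + |a| * (q ^ (m + 1) * Q) := by
          gcongr
          · exact ih m (by omega)
          · exact ih (m + 1) (by omega)
      _ = (‖l‖ + |a| * q) * (q ^ m * Q) := by ring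
      _ ≤ q ^ 3 * (q ^ m * Q) := by gcongr
      _ = q ^ (m + 3) * Q := by ring

theorem exists_norm_eigenfun_le_of_norm_le_one (a : ℝ) : ∃ Q, ∀ l : ℂ, ‖l‖ ≤ 1 →
    ∀ x ∈ Icc (-1 : ℝ) 0, ∀ k ≤ 2, ‖eigenfun a l k x‖ ≤ Q := by
  set D := 16 * 1 * (1 + |a|) with hD
  have hD1 : 1 ≤ D := by rw [hD]; linarith [abs_nonneg a]
  set S := ∑' k : ℕ, D ^ k / (k / 3).factorial
  have : 0 ≤ S := tsum_nonneg fun _ => by positivity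
  refine ⟨1 * S * D ^ 2 * 2, fun l hl x hx k hk => ?_⟩
  have hpow (n : ℕ) : ‖l ^ n‖ ≤ 1 * 1 ^ n * (n.factorial : ℝ) ^ 2 := by
    rw [norm_pow, one_pow, one_mul, one_mul]
    exact (pow_le_one₀ (norm_nonneg l) hl).trans
      (one_le_pow₀ (Nat.one_le_cast.2 n.factorial_pos))
  have hfactorial : (k.factorial : ℝ) ≤ 2 := mod_cast Nat.factorial_le hk
  calc ‖eigenfun a l k x‖ ≤ 1 * S * D ^ (k + 0) * (k.factorial * ((0 : ℕ).factorial : ℝ) ^ 2) :=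
        norm_taylorFlow_le le_rfl hpow (abs_lt_two_of_mem hx).le k 0
    _ = 1 * S * D ^ k * k.factorial := by simp
    _ ≤ 1 * S * D ^ 2 * 2 := by gcongr

/-- The component of the solution `eigenfun` along a cube root `r` of `l`, which grows at the rate
`r` up to a perturbation caused by `a`. -/
noncomputable def cubeRootMode (a : ℝ) (l r : ℂ) (x : ℝ) : ℂ :=
  eigenfun a l 2 x + r * eigenfun a l 1 x + r ^ 2 * eigenfun a l 0 x

theorem hasDerivAt_cubeRootMode {r : ℂ} (hr : r ^ 3 = l) (hx : |x| < 2) :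
    HasDerivAt (cubeRootMode a l r) (r * cubeRootMode a l r x - a * eigenfun a l 1 x) x := by
  refine (((hasDerivAt_eigenfun hx 2).add ((hasDerivAt_eigenfun hx 1).const_mul r)).add
    ((hasDerivAt_eigenfun hx 0).const_mul (r ^ 2))).congr_deriv ?_
  rw [cubeRootMode, eigenfun_add_three hx.le, ← hr]
  ring

theorem cubeRootMode_zero_right (r : ℂ) : cubeRootMode a l r 0 = 1 := by
  rw [cubeRootMode, eigenfun_zero_right, eigenfun_one_zero_right, eigenfun_two_zero_right]
  ring

theorem three_mul_pow_mul_eigenfun {r ζ : ℂ} (hζ : 1 + ζ + ζ ^ 2 = 0) {k : ℕ} (hk : k ≤ 2) :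
    3 * r ^ (2 - k) * eigenfun a l k x
      = ∑ j : Fin 3, ζ ^ ((k + 1) * (j : ℕ)) * cubeRootMode a l (ζ ^ (j : ℕ) * r) x := by
  have : ζ ^ 3 = 1 := by linear_combination (ζ - 1) * hζ
  simp only [Fin.sum_univ_three, Fin.val_zero, Fin.val_one, Fin.val_two, cubeRootMode]
  interval_cases k <;> norm_num <;> grind

theorem three_mul_norm_eigenfun_le {r ζ : ℂ} (hζ : 1 + ζ + ζ ^ 2 = 0) (hζ1 : ‖ζ‖ = 1)
    (hr : 1 ≤ ‖r‖) (x : ℝ) {k : ℕ} (hk : k ≤ 2) :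
    3 * ‖eigenfun a l k x‖ ≤ ∑ j : Fin 3, ‖cubeRootMode a l (ζ ^ (j : ℕ) * r) x‖ :=
  calc 3 * ‖eigenfun a l k x‖ ≤ 3 * (‖r‖ ^ (2 - k) * ‖eigenfun a l k x‖) := by
        gcongr
        exact le_mul_of_one_le_left (norm_nonneg _) (one_le_pow₀ hr)
    _ = ‖∑ j : Fin 3, ζ ^ ((k + 1) * (j : ℕ)) * cubeRootMode a l (ζ ^ (j : ℕ) * r) x‖ := by
        rw [← three_mul_pow_mul_eigenfun hζ hk]; simp [mul_assoc]
    _ ≤ ∑ j : Fin 3, ‖cubeRootMode a l (ζ ^ (j : ℕ) * r) x‖ :=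
        (norm_sum_le _ _).trans_eq (by simp [hζ1])

theorem neg_le_inner_mul_sub {r u g : ℂ} {b : ℝ} (hr : (-r).re ≤ b) :
    -(b * ‖u‖ ^ 2 + |a| * (‖u‖ * ‖g‖)) ≤ inner ℝ u (r * u - a * g) := by
  have hsplit : inner ℝ u (r * u - a * g) = -((-r).re * ‖u‖ ^ 2) - a * inner ℝ u g := by
    rw [Complex.inner, Complex.inner, ← Complex.normSq_eq_norm_sq, Complex.normSq_apply]
    simp
    ring
  have hcross : a * inner ℝ u g ≤ |a| * (‖u‖ * ‖g‖) :=
    (le_abs_self _).trans (by rw [abs_mul]; gcongr; exact abs_real_inner_le_norm u g)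
  have hdiag : (-r).re * ‖u‖ ^ 2 ≤ b * ‖u‖ ^ 2 := by gcongr
  linarith

theorem neg_mul_sum_sq_le_sum_inner {b : ℝ} {r : Fin 3 → ℂ} {u : Fin 3 → ℂ} {g : ℂ}
    (hr : ∀ j, (-r j).re ≤ b) (hg : 3 * ‖g‖ ≤ ∑ j, ‖u j‖) :
    -((b + |a|) * ∑ j, ‖u j‖ ^ 2) ≤ ∑ j, inner ℝ (u j) (r j * u j - a * g) := by
  have hcross : (∑ j, ‖u j‖) * ‖g‖ ≤ ∑ j, ‖u j‖ ^ 2 := by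
    have hcauchy : (∑ j, ‖u j‖) ^ 2 ≤ 3 * ∑ j, ‖u j‖ ^ 2 := by
      simpa using sq_sum_le_card_mul_sum_sq (s := Finset.univ) (f := fun j => ‖u j‖)
    have hsum : 0 ≤ ∑ j, ‖u j‖ := Finset.sum_nonneg fun j _ => norm_nonneg (u j)
    nlinarith [mul_le_mul_of_nonneg_left hg hsum]
  calc -((b + |a|) * ∑ j, ‖u j‖ ^ 2)
      ≤ -(b * ∑ j, ‖u j‖ ^ 2 + |a| * ((∑ j, ‖u j‖) * ‖g‖)) := by
        rw [add_mul]
        gcongr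
    _ = ∑ j, -(b * ‖u j‖ ^ 2 + |a| * (‖u j‖ * ‖g‖)) := by
        rw [Finset.sum_neg_distrib, Finset.sum_add_distrib, Finset.mul_sum, Finset.sum_mul,
          Finset.mul_sum]
    _ ≤ ∑ j, inner ℝ (u j) (r j * u j - a * g) :=
        Finset.sum_le_sum fun j _ => neg_le_inner_mul_sub (hr j)

theorem sum_sq_cubeRootMode_mul_exp_le {b : ℝ} {r ζ : ℂ} (hζ : 1 + ζ + ζ ^ 2 = 0)
    (hζ1 : ‖ζ‖ = 1) (hr : 1 ≤ ‖r‖) (hrl : r ^ 3 = l) (hb : ∀ w : ℂ, w ^ 3 = -l → w.re ≤ b)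
    (hx : x ∈ Icc (-1 : ℝ) 0) :
    (∑ j : Fin 3, ‖cubeRootMode a l (ζ ^ (j : ℕ) * r) x‖ ^ 2) * Real.exp (2 * (b + |a|) * x)
      ≤ 3 := by
  have hroot (j : Fin 3) : (ζ ^ (j : ℕ) * r) ^ 3 = l := by
    have hζ3 : ζ ^ 3 = 1 := by linear_combination (ζ - 1) * hζ
    rw [mul_pow, ← pow_mul, mul_comm, mul_comm (j : ℕ), pow_mul, hζ3, one_pow, mul_one, hrl]
  have hderiv (y : ℝ) (hy : y ∈ Icc (-1 : ℝ) 0) :=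
    (HasDerivAt.fun_sum fun (j : Fin 3) (_ : j ∈ Finset.univ) =>
      (hasDerivAt_cubeRootMode (a := a) (hroot j) (abs_lt_two_of_mem hy)).norm_sq).mul
      ((hasDerivAt_id y).const_mul (2 * (b + |a|))).exp
  have hmono : MonotoneOn (fun y => (∑ j : Fin 3, ‖cubeRootMode a l (ζ ^ (j : ℕ) * r) y‖ ^ 2)
      * Real.exp (2 * (b + |a|) * y)) (Icc (-1) 0) := by
    refine monotoneOn_of_hasDerivWithinAt_nonneg (convex_Icc _ _)
      (fun y hy => (hderiv y hy).continuousAt.continuousWithinAt)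
      (fun y hy => (hderiv y (interior_subset hy)).hasDerivWithinAt) fun y _ => ?_
    have hinner := neg_mul_sum_sq_le_sum_inner (a := a)
      (r := fun j => ζ ^ (j : ℕ) * r)
      (fun j => hb _ (by rw [neg_pow, hroot j]; ring))
      (three_mul_norm_eigenfun_le (a := a) (l := l) hζ hζ1 hr y one_le_two)
    rw [← Finset.mul_sum, id, mul_one, mul_comm (Real.exp _), ← mul_assoc, ← add_mul]
    refine mul_nonneg ?_ (Real.exp_pos _).le
    linarith
  calc _ ≤ _ := hmono hx ⟨by norm_num, le_rfl⟩ hx.2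
    _ = 3 := by simp [cubeRootMode_zero_right]

theorem norm_eigenfun_le_exp {b : ℝ} (hb0 : 0 ≤ b) (hl : 1 ≤ ‖l‖)
    (hb : ∀ w : ℂ, w ^ 3 = -l → w.re ≤ b) (hx : x ∈ Icc (-1 : ℝ) 0) {k : ℕ} (hk : k ≤ 2) :
    ‖eigenfun a l k x‖ ≤ Real.exp (|a| + b) := by
  obtain ⟨r, hrl⟩ := IsAlgClosed.exists_pow_nat_eq l (n := 3) (by norm_num)
  have hr : 1 ≤ ‖r‖ := by
    by_contra! h
    exact hl.not_gt (by rw [← hrl, norm_pow]; exact pow_lt_one₀ (norm_nonneg r) h (by norm_num))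
  obtain ⟨ζ, hprim⟩ : ∃ ζ : ℂ, IsPrimitiveRoot ζ 3 :=
    ⟨_, Complex.isPrimitiveRoot_exp 3 (by norm_num)⟩
  have hζ : 1 + ζ + ζ ^ 2 = 0 := by
    simpa [Finset.sum_range_succ] using hprim.geom_sum_eq_zero (by norm_num)
  have hζ1 : ‖ζ‖ = 1 := hprim.norm'_eq_one (by norm_num)
  set N := ∑ j : Fin 3, ‖cubeRootMode a l (ζ ^ (j : ℕ) * r) x‖ ^ 2
  have hN : N ≤ 3 * Real.exp (|a| + b) ^ 2 := by
    have hweight := sum_sq_cubeRootMode_mul_exp_le (a := a) hζ hζ1 hr hrl hb hx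
    have hexp : Real.exp (-(|a| + b)) ^ 2 ≤ Real.exp (2 * (b + |a|) * x) := by
      rw [← Real.exp_nat_mul, Real.exp_le_exp]
      push_cast
      nlinarith [hx.1, abs_nonneg a]
    have hN0 : 0 ≤ N := Finset.sum_nonneg fun _ _ => by positivity
    calc N = N * Real.exp (-(|a| + b)) ^ 2 * Real.exp (|a| + b) ^ 2 := by
          rw [mul_assoc, ← mul_pow, ← Real.exp_add]; simp
      _ ≤ 3 * Real.exp (|a| + b) ^ 2 := by
          gcongr
          exact (mul_le_mul_of_nonneg_left hexp hN0).trans hweight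
  have hcauchy : (∑ j : Fin 3, ‖cubeRootMode a l (ζ ^ (j : ℕ) * r) x‖) ^ 2 ≤ 3 * N := by
    simpa using sq_sum_le_card_mul_sum_sq (s := Finset.univ)
      (f := fun j : Fin 3 => ‖cubeRootMode a l (ζ ^ (j : ℕ) * r) x‖)
  have h3 := three_mul_norm_eigenfun_le (a := a) (l := l) hζ hζ1 hr x hk
  refine le_of_mul_le_mul_left (h3.trans (le_of_sq_le_sq ?_ (by positivity))) three_pos
  linarith

theorem exists_norm_eigenfun_le (a : ℝ) : ∃ Q, 0 < Q ∧ ∀ (l : ℂ) (s b : ℝ), 0 ≤ s → 0 ≤ b →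
    ‖l‖ ≤ s ^ 3 → (∀ w : ℂ, w ^ 3 = -l → w.re ≤ b) → ∀ m, ∀ x ∈ Icc (-1 : ℝ) 0,
      ‖eigenfun a l m x‖ ≤ ((1 + |a|) * (1 + s)) ^ m * (Q * Real.exp b) := by
  obtain ⟨Q, hQ⟩ := exists_norm_eigenfun_le_of_norm_le_one a
  refine ⟨max Q (Real.exp |a|), by positivity, fun l s b hs hb0 hl hb m x hx => ?_⟩
  have ha := abs_nonneg a
  refine norm_eigenfun_le_pow (abs_lt_two_of_mem hx).le (by nlinarith) ?_ (fun k hk => ?_) m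
  · calc ‖l‖ + |a| * ((1 + |a|) * (1 + s)) ≤ (1 + s) ^ 3 + |a| * ((1 + |a|) * (1 + s)) := by
          gcongr
          exact hl.trans (by gcongr; linarith)
      _ = (1 + s) * ((1 + s) ^ 2 + |a| * (1 + |a|)) := by ring
      _ ≤ (1 + s) * ((1 + |a|) ^ 3 * (1 + s) ^ 2) := by
          have hs2 : 1 ≤ (1 + s) ^ 2 := one_le_pow₀ (by linarith)
          gcongr
          nlinarith [mul_nonneg ha (sub_nonneg.2 hs2), pow_nonneg ha 3,
            mul_nonneg (pow_nonneg ha 2) (sub_nonneg.2 hs2),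
            mul_nonneg (pow_nonneg ha 3) (sub_nonneg.2 hs2)]
      _ = ((1 + |a|) * (1 + s)) ^ 3 := by ring
  · rcases le_total ‖l‖ 1 with h | h
    · exact (hQ l h x hx k hk).trans ((le_max_left _ _).trans
        (le_mul_of_one_le_right (by positivity) (Real.one_le_exp hb0)))
    · refine (norm_eigenfun_le_exp hb0 h hb hx hk).trans ?_
      rw [Real.exp_add]
      gcongr
      exact le_max_right _ _

end Eigenfun

/-! ### Gevrey functions of order 2 -/

/-- Gevrey functions of order `2` on the whole line, given by the sequence of their derivatives. -/
structure IsGevreyTwo (f : ℕ → ℝ → ℝ) : Prop where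
  hasDerivAt : ∀ n t, HasDerivAt (f n) (f (n + 1) t) t
  bound : ∃ K L : ℝ, 1 ≤ L ∧ ∀ n t, |f n t| ≤ K * L ^ n * (n.factorial : ℝ) ^ 2

/-- The `n`-th derivative of the product of two functions, given by the sequences `f` and `g` of
their derivatives, by Leibniz' rule. -/
def leibniz (f g : ℕ → ℝ → ℝ) (n : ℕ) (t : ℝ) : ℝ :=
  ∑ ij ∈ Finset.HasAntidiagonal.antidiagonal n, (n.choose ij.1 : ℝ) * (f ij.1 t * g ij.2 t)

section Leibniz

variable {f g : ℕ → ℝ → ℝ} {t K L K' L' : ℝ}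

theorem leibniz_zero : leibniz f g 0 t = f 0 t * g 0 t := by simp [leibniz]

theorem leibniz_eq_zero_of_left (hf : ∀ n, f n t = 0) (n : ℕ) : leibniz f g n t = 0 :=
  Finset.sum_eq_zero fun ij _ => by rw [hf, zero_mul, mul_zero]

theorem leibniz_eq_zero_of_right (hg : ∀ n, g n t = 0) (n : ℕ) : leibniz f g n t = 0 :=
  Finset.sum_eq_zero fun ij _ => by rw [hg, mul_zero, mul_zero]

theorem leibniz_of_eq_one (h0 : f 0 t = 1) (h1 : ∀ n, f (n + 1) t = 0) (n : ℕ) :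
    leibniz f g n t = g n t := by
  rw [leibniz, Finset.sum_eq_single (0, n)]
  · simp [h0]
  · rintro ⟨i, j⟩ hij hne
    cases i with
    | zero => simp_all
    | succ i => simp [h1]
  · simp

theorem hasDerivAt_leibniz (hf : ∀ n, HasDerivAt (f n) (f (n + 1) t) t)
    (hg : ∀ n, HasDerivAt (g n) (g (n + 1) t) t) (n : ℕ) :
    HasDerivAt (leibniz f g n) (leibniz f g (n + 1) t) t := by
  have hterms : HasDerivAt (leibniz f g n) (∑ ij ∈ Finset.HasAntidiagonal.antidiagonal n,
      (n.choose ij.1 : ℝ) * (f (ij.1 + 1) t * g ij.2 t + f ij.1 t * g (ij.2 + 1) t)) t :=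
    HasDerivAt.fun_sum fun ij _ => ((hf ij.1).mul (hg ij.2)).const_mul _
  refine hterms.congr_deriv ?_
  rw [leibniz, Finset.sum_antidiagonal_choose_succ_mul (fun i j => f i t * g j t),
    ← Finset.sum_add_distrib]
  refine Finset.sum_congr rfl fun ij hij => ?_
  rw [← Finset.HasAntidiagonal.mem_antidiagonal.1 hij, Nat.choose_symm_add]
  ring

theorem abs_leibniz_le (hL : 0 ≤ L) (hL' : 0 ≤ L')
    (hf : ∀ n, |f n t| ≤ K * L ^ n * (n.factorial : ℝ) ^ 2)
    (hg : ∀ n, |g n t| ≤ K' * L' ^ n * (n.factorial : ℝ) ^ 2) (n : ℕ) :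
    |leibniz f g n t| ≤ K * K' * (L + L') ^ n * (n.factorial : ℝ) ^ 2 := by
  have hK : 0 ≤ K := by simpa using (abs_nonneg _).trans (hf 0)
  have hK' : 0 ≤ K' := by simpa using (abs_nonneg _).trans (hg 0)
  have hterm (i j : ℕ) : |((i + j).choose i : ℝ) * (f i t * g j t)|
      ≤ K * K' * ((i + j).factorial : ℝ) ^ 2 * ((i + j).choose i • (L ^ i * L' ^ j)) := by
    rw [abs_mul, abs_mul, Nat.abs_cast, nsmul_eq_mul]
    calc ((i + j).choose i : ℝ) * (|f i t| * |g j t|)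
        ≤ (i + j).choose i * ((K * L ^ i * (i.factorial : ℝ) ^ 2)
          * (K' * L' ^ j * (j.factorial : ℝ) ^ 2)) := by
          gcongr
          · exact hf _
          · exact hg _
      _ = (i + j).choose i * (K * L ^ i * (K' * L' ^ j)) * (i.factorial * j.factorial : ℝ) ^ 2 := by
          ring
      _ ≤ (i + j).choose i * (K * L ^ i * (K' * L' ^ j)) * ((i + j).factorial : ℝ) ^ 2 := by
          gcongr
          exact factorial_mul_factorial_le i j
      _ = _ := by ring
  calc |leibniz f g n t| ≤ ∑ ij ∈ Finset.HasAntidiagonal.antidiagonal n,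
          |(n.choose ij.1 : ℝ) * (f ij.1 t * g ij.2 t)| := Finset.abs_sum_le_sum_abs _ _
    _ ≤ ∑ ij ∈ Finset.HasAntidiagonal.antidiagonal n,
          K * K' * (n.factorial : ℝ) ^ 2 * (n.choose ij.1 • (L ^ ij.1 * L' ^ ij.2)) := by
        refine Finset.sum_le_sum fun ij hij => ?_
        rw [← Finset.HasAntidiagonal.mem_antidiagonal.1 hij]
        exact hterm _ _
    _ = _ := by rw [← Finset.mul_sum, (Commute.all L L').add_pow' n]; ring

end Leibniz

namespace IsGevreyTwo

variable {f g : ℕ → ℝ → ℝ}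

theorem isDerivSeq (hf : IsGevreyTwo f) : IsDerivSeq univ f :=
  fun n t _ => (hf.hasDerivAt n t).hasDerivWithinAt

theorem leibniz (hf : IsGevreyTwo f) (hg : IsGevreyTwo g) : IsGevreyTwo (leibniz f g) where
  hasDerivAt n t := hasDerivAt_leibniz (fun n => hf.hasDerivAt n t) (fun n => hg.hasDerivAt n t) n
  bound := by
    obtain ⟨K, L, hL, hb⟩ := hf.bound
    obtain ⟨K', L', hL', hb'⟩ := hg.bound
    exact ⟨K * K', L + L', by linarith, fun n t => abs_leibniz_le (by linarith) (by linarith)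
      (fun n => hb n t) (fun n => hb' n t) n⟩

theorem comp_affine (hf : IsGevreyTwo f) (b c : ℝ) :
    IsGevreyTwo (fun n t => c ^ n * f n (b + c * t)) where
  hasDerivAt n t := by
    have haffine : HasDerivAt (fun t : ℝ => b + c * t) c t := by
      simpa using ((hasDerivAt_id t).const_mul c).const_add b
    refine (((hf.hasDerivAt n (b + c * t)).comp t haffine).const_mul (c ^ n)).congr_deriv ?_
    ring
  bound := by
    obtain ⟨K, L, hL, hb⟩ := hf.bound
    refine ⟨K, (1 + |c|) * L, by nlinarith [abs_nonneg c], fun n t => ?_⟩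
    rw [abs_mul, abs_pow]
    calc |c| ^ n * |f n (b + c * t)| ≤ (1 + |c|) ^ n * (K * L ^ n * (n.factorial : ℝ) ^ 2) := by
          gcongr
          · linarith
          · exact hb n _
      _ = _ := by rw [mul_pow]; ring

end IsGevreyTwo

/-! ### The flat function `e^{-1/t}` -/

/-- The derivatives of the function `e^{-1/t}` extended by zero to `t ≤ 0`. They are taken in the
complex domain, where Cauchy's estimates bound them. -/
noncomputable def flatExp (n : ℕ) (t : ℝ) : ℝ :=
  if 0 < t then (iteratedDeriv n (fun z : ℂ => Complex.exp (-z⁻¹)) (t : ℂ)).re else 0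

section FlatExp

variable {t : ℝ} {z : ℂ}

theorem flatExp_of_pos (n : ℕ) (ht : 0 < t) :
    flatExp n t = (iteratedDeriv n (fun z : ℂ => Complex.exp (-z⁻¹)) (t : ℂ)).re := if_pos ht

theorem flatExp_of_nonpos (n : ℕ) (ht : t ≤ 0) : flatExp n t = 0 := if_neg (not_lt.2 ht)

theorem flatExp_zero_pos (ht : 0 < t) : 0 < flatExp 0 t := by
  rw [flatExp_of_pos 0 ht, iteratedDeriv_zero, ← Complex.ofReal_inv, ← Complex.ofReal_neg,
    Complex.exp_ofReal_re]
  exact Real.exp_pos _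

theorem flatExp_zero_nonneg (t : ℝ) : 0 ≤ flatExp 0 t := by
  rcases lt_or_ge 0 t with ht | ht
  · exact (flatExp_zero_pos ht).le
  · exact (flatExp_of_nonpos 0 ht).ge

theorem hasDerivAt_iteratedDeriv {𝕜 E : Type*} [NontriviallyNormedField 𝕜] [NormedAddCommGroup E]
    [NormedSpace 𝕜 E] [CompleteSpace E] {f : 𝕜 → E} {z : 𝕜} (hf : AnalyticAt 𝕜 f z) (n : ℕ) :
    HasDerivAt (iteratedDeriv n f) (iteratedDeriv (n + 1) f z) z := by
  rw [iteratedDeriv_succ, iteratedDeriv_eq_iterate]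
  exact (hf.iterated_deriv n).differentiableAt.hasDerivAt

theorem differentiableAt_cexp_neg_inv (hz : z ≠ 0) :
    DifferentiableAt ℂ (fun z : ℂ => Complex.exp (-z⁻¹)) z :=
  (differentiableAt_inv hz).neg.cexp

theorem half_le_re_of_mem_closedBall (hz : z ∈ Metric.closedBall (t : ℂ) (t / 2)) :
    t / 2 ≤ z.re := by
  have hre := (Complex.abs_re_le_norm (z - t)).trans (mem_closedBall_iff_norm.1 hz)
  rw [Complex.sub_re, Complex.ofReal_re, abs_le] at hre
  linarith

theorem norm_cexp_neg_inv_le (ht : 0 < t) (hz : z ∈ Metric.closedBall (t : ℂ) (t / 2)) :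
    ‖Complex.exp (-z⁻¹)‖ ≤ Real.exp (-(2 / (9 * t))) := by
  have hre := half_le_re_of_mem_closedBall hz
  have hnorm : ‖z‖ ≤ t + t / 2 := by
    simpa [abs_of_pos ht] using norm_le_norm_add_const_of_dist_le (Metric.mem_closedBall.1 hz)
  have hz0 : 0 < ‖z‖ := by linarith [Complex.re_le_norm z]
  rw [Complex.norm_exp, Real.exp_le_exp, Complex.neg_re, Complex.inv_re, neg_le_neg_iff,
    Complex.normSq_eq_norm_sq, div_le_div_iff₀ (by positivity) (by positivity)]
  nlinarith [pow_le_pow_left₀ hz0.le hnorm 2]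

theorem abs_flatExp_le (n : ℕ) (ht : 0 < t) :
    |flatExp n t| ≤ n.factorial * Real.exp (-(2 / (9 * t))) / (t / 2) ^ n := by
  rw [flatExp_of_pos n ht]
  refine (Complex.abs_re_le_norm _).trans
    (Complex.norm_iteratedDeriv_le_of_forall_mem_sphere_norm_le n (by positivity) ?_
      fun z hz => norm_cexp_neg_inv_le ht (Metric.sphere_subset_closedBall hz))
  refine DifferentiableOn.diffContOnCl fun z hz =>
    (differentiableAt_cexp_neg_inv ?_).differentiableWithinAt
  rintro rfl
  have hre := half_le_re_of_mem_closedBall (Metric.closure_ball_subset_closedBall hz)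
  rw [Complex.zero_re] at hre
  linarith

theorem abs_flatExp_le_mul_pow (n k : ℕ) (ht : 0 < t) :
    |flatExp n t| ≤ n.factorial * (n + k).factorial * 9 ^ n * (9 / 2 * t) ^ k := by
  have hexp : Real.exp (-(2 / (9 * t))) ≤ (n + k).factorial * (9 / 2 * t) ^ (n + k) := by
    have h := pow_mul_exp_neg_le (show 0 < 2 / (9 * t) by positivity) zero_le_one (n + k)
    rw [one_pow, one_mul, mul_one, show (2 / (9 * t))⁻¹ = 9 / 2 * t by field_simp] at h
    exact h.trans_eq (mul_comm _ _)
  calc |flatExp n t| ≤ n.factorial * Real.exp (-(2 / (9 * t))) / (t / 2) ^ n := abs_flatExp_le n ht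
    _ ≤ n.factorial * ((n + k).factorial * (9 / 2 * t) ^ (n + k)) / (t / 2) ^ n := by gcongr
    _ = n.factorial * (n + k).factorial * 9 ^ n * (9 / 2 * t) ^ k := by
        rw [pow_add, show 9 / 2 * t = 9 * (t / 2) by ring, mul_pow _ _ n]
        field_simp

theorem hasDerivAt_flatExp_zero (n : ℕ) : HasDerivAt (flatExp n) (flatExp (n + 1) 0) 0 := by
  rw [flatExp_of_nonpos (n + 1) le_rfl, hasDerivAt_iff_isLittleO]
  simp only [flatExp_of_nonpos n le_rfl, sub_zero, smul_zero]
  refine (Asymptotics.IsBigO.of_bound (n.factorial * (n + 2).factorial * 9 ^ n * (9 / 2) ^ 2)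
    (Eventually.of_forall fun s => ?_)).trans_isLittleO (Asymptotics.isLittleO_pow_id one_lt_two)
  rw [norm_pow, Real.norm_eq_abs, Real.norm_eq_abs, sq_abs, mul_assoc, ← mul_pow]
  rcases lt_or_ge 0 s with hs | hs
  · exact abs_flatExp_le_mul_pow n 2 hs
  · rw [flatExp_of_nonpos n hs, abs_zero]
    positivity

theorem hasDerivAt_flatExp_of_pos (n : ℕ) (ht : 0 < t) :
    HasDerivAt (flatExp n) (flatExp (n + 1) t) t := by
  set f : ℂ → ℂ := fun z => Complex.exp (-z⁻¹)
  have hanalytic : AnalyticAt ℂ f t :=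
    DifferentiableOn.analyticAt (s := {0}ᶜ)
      (fun z hz => (differentiableAt_cexp_neg_inv hz).differentiableWithinAt)
      (isOpen_compl_singleton.mem_nhds (Complex.ofReal_ne_zero.2 ht.ne'))
  rw [flatExp_of_pos (n + 1) ht]
  refine (hasDerivAt_iteratedDeriv hanalytic n).real_of_complex.congr_of_eventuallyEq ?_
  filter_upwards [Ioi_mem_nhds ht] with s hs
  exact flatExp_of_pos n hs

theorem isGevreyTwo_flatExp : IsGevreyTwo flatExp where
  hasDerivAt n t := by
    rcases lt_trichotomy t 0 with ht | rfl | ht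
    · rw [flatExp_of_nonpos (n + 1) ht.le]
      refine (hasDerivAt_const t (0 : ℝ)).congr_of_eventuallyEq ?_
      filter_upwards [Iio_mem_nhds ht] with s hs
      exact flatExp_of_nonpos n (mem_Iio.1 hs).le
    · exact hasDerivAt_flatExp_zero n
    · exact hasDerivAt_flatExp_of_pos n ht
  bound := by
    refine ⟨1, 9, by norm_num, fun n t => ?_⟩
    rcases lt_or_ge 0 t with ht | ht
    · exact (abs_flatExp_le_mul_pow n 0 ht).trans_eq (by rw [add_zero, pow_zero]; ring)
    · rw [flatExp_of_nonpos n ht, abs_zero]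
      positivity

end FlatExp

/-- The derivatives of the bump function `e^{-1/t} e^{-1/(1-t)}` supported in `[0, 1]`. -/
noncomputable def flatBump : ℕ → ℝ → ℝ :=
  leibniz flatExp fun n t => (-1) ^ n * flatExp n (1 + -1 * t)

/-- The derivatives of the normalized primitive of `flatBump 0`, which steps from `0` to `1` in the
interval `[0, 1]`. -/
noncomputable def flatStep : ℕ → ℝ → ℝ
  | 0, t => (∫ s in (0 : ℝ)..t, flatBump 0 s) / ∫ s in (0 : ℝ)..1, flatBump 0 s
  | n + 1, t => flatBump n t / ∫ s in (0 : ℝ)..1, flatBump 0 s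

section Cutoff

variable {t : ℝ}

theorem isGevreyTwo_flatBump : IsGevreyTwo flatBump :=
  isGevreyTwo_flatExp.leibniz (isGevreyTwo_flatExp.comp_affine 1 (-1))

theorem flatBump_of_nonpos (n : ℕ) (ht : t ≤ 0) : flatBump n t = 0 :=
  leibniz_eq_zero_of_left (fun n => flatExp_of_nonpos n ht) n

theorem flatBump_of_one_le (n : ℕ) (ht : 1 ≤ t) : flatBump n t = 0 :=
  leibniz_eq_zero_of_right (fun n => by rw [flatExp_of_nonpos n (by linarith), mul_zero]) n

theorem flatBump_zero (t : ℝ) : flatBump 0 t = flatExp 0 t * flatExp 0 (1 + -1 * t) := by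
  rw [flatBump, leibniz_zero, pow_zero, one_mul]

theorem continuous_flatBump_zero : Continuous (flatBump 0) :=
  continuous_iff_continuousAt.2 fun t => (isGevreyTwo_flatBump.hasDerivAt 0 t).continuousAt

theorem integral_flatBump_pos : 0 < ∫ s in (0 : ℝ)..1, flatBump 0 s := by
  refine intervalIntegral.intervalIntegral_pos_of_pos_on
    (continuous_flatBump_zero.intervalIntegrable _ _) (fun t ht => ?_) one_pos
  rw [flatBump_zero]
  exact mul_pos (flatExp_zero_pos ht.1) (flatExp_zero_pos (by linarith [ht.2]))

theorem flatStep_of_nonpos (n : ℕ) (ht : t ≤ 0) : flatStep n t = 0 := by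
  cases n with
  | zero =>
    have hint : ∫ s in (0 : ℝ)..t, flatBump 0 s = ∫ _s in (0 : ℝ)..t, (0 : ℝ) :=
      intervalIntegral.integral_congr fun s hs => by
        rw [uIcc_of_ge ht] at hs
        exact flatBump_of_nonpos 0 hs.2
    rw [flatStep, hint, intervalIntegral.integral_zero, zero_div]
  | succ n => rw [flatStep, flatBump_of_nonpos n ht, zero_div]

theorem flatStep_zero_of_one_le (ht : 1 ≤ t) : flatStep 0 t = 1 := by
  have hint : ∫ s in (1 : ℝ)..t, flatBump 0 s = ∫ _s in (1 : ℝ)..t, (0 : ℝ) :=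
    intervalIntegral.integral_congr fun s hs => by
      rw [uIcc_of_le ht] at hs
      exact flatBump_of_one_le 0 hs.1
  rw [flatStep, ← intervalIntegral.integral_add_adjacent_intervals
    (continuous_flatBump_zero.intervalIntegrable 0 1)
    (continuous_flatBump_zero.intervalIntegrable 1 t), hint, intervalIntegral.integral_zero,
    add_zero, div_self integral_flatBump_pos.ne']

theorem flatStep_succ_of_one_le (n : ℕ) (ht : 1 ≤ t) : flatStep (n + 1) t = 0 := by
  rw [flatStep, flatBump_of_one_le n ht, zero_div]

theorem abs_flatStep_zero_le_one (t : ℝ) : |flatStep 0 t| ≤ 1 := by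
  rcases le_total t 0 with ht | ht
  · simp [flatStep_of_nonpos 0 ht]
  rcases le_total 1 t with ht' | ht'
  · simp [flatStep_zero_of_one_le ht']
  have hnonneg (s : ℝ) : 0 ≤ flatBump 0 s := by
    rw [flatBump_zero]
    exact mul_nonneg (flatExp_zero_nonneg _) (flatExp_zero_nonneg _)
  rw [flatStep, abs_div, abs_of_pos integral_flatBump_pos,
    abs_of_nonneg (intervalIntegral.integral_nonneg ht fun s _ => hnonneg s),
    div_le_one integral_flatBump_pos]
  exact intervalIntegral.integral_mono_interval le_rfl ht ht' (MeasureTheory.ae_of_all _ hnonneg)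
    (continuous_flatBump_zero.intervalIntegrable 0 1)

theorem isGevreyTwo_flatStep : IsGevreyTwo flatStep where
  hasDerivAt n t := by
    cases n with
    | zero => exact (continuous_flatBump_zero.integral_hasStrictDerivAt 0 t).hasDerivAt.div_const _
    | succ n => exact (isGevreyTwo_flatBump.hasDerivAt n t).div_const _
  bound := by
    obtain ⟨K, L, hL, hb⟩ := isGevreyTwo_flatBump.bound
    have hK : 0 ≤ K := by simpa using (abs_nonneg _).trans (hb 0 0)
    set c := ∫ s in (0 : ℝ)..1, flatBump 0 s with hc
    have hc0 : 0 < c := integral_flatBump_pos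
    have hKc : 0 ≤ K / c := by positivity
    refine ⟨1 + K / c, L, hL, fun n t => ?_⟩
    cases n with
    | zero => simpa using (abs_flatStep_zero_le_one t).trans (by linarith)
    | succ n =>
      rw [flatStep, ← hc, abs_div, abs_of_pos hc0]
      calc |flatBump n t| / c ≤ (K * L ^ n * (n.factorial : ℝ) ^ 2) / c := by gcongr; exact hb n t
        _ = K / c * L ^ n * (n.factorial : ℝ) ^ 2 := by ring
        _ ≤ (1 + K / c) * L ^ (n + 1) * ((n + 1).factorial : ℝ) ^ 2 := by
          gcongr
          · linarith
          · omega
          · omega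

theorem exists_cutoff {t₁ t₂ : ℝ} (h : t₁ < t₂) : ∃ χ : ℕ → ℝ → ℝ, IsGevreyTwo χ ∧
    (∀ n, ∀ t ≤ t₁, χ n t = 0) ∧ (∀ t, t₂ ≤ t → χ 0 t = 1) ∧ ∀ n t, t₂ ≤ t → χ (n + 1) t = 0 := by
  set c := (t₂ - t₁)⁻¹
  have hc : 0 < c := inv_pos.2 (by linarith)
  have haffine (t : ℝ) : -(t₁ * c) + c * t = c * (t - t₁) := by ring
  have hright {t : ℝ} (ht : t₂ ≤ t) : 1 ≤ -(t₁ * c) + c * t := by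
    rw [haffine, ← inv_mul_cancel₀ (sub_pos.2 h).ne']
    gcongr
  refine ⟨_, isGevreyTwo_flatStep.comp_affine (-(t₁ * c)) c, fun n t ht => ?_, fun t ht => ?_,
    fun n t ht => ?_⟩
  · rw [flatStep_of_nonpos n ?_, mul_zero]
    rw [haffine]
    exact mul_nonpos_of_nonneg_of_nonpos hc.le (by linarith)
  · rw [flatStep_zero_of_one_le (hright ht), pow_zero, one_mul]
  · rw [flatStep_succ_of_one_le n (hright ht), mul_zero]

theorem isGevreyTwo_leibniz_cutoff {χ z : ℕ → ℝ → ℝ} {t₁ K L : ℝ} (ht₁ : 0 < t₁)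
    (hχ : IsGevreyTwo χ) (hχ0 : ∀ n, ∀ t ≤ t₁, χ n t = 0) (hL : 0 ≤ L)
    (hz : ∀ n, ∀ t > 0, HasDerivAt (z n) (z (n + 1) t) t)
    (hb : ∀ n t, t₁ ≤ t → |z n t| ≤ K * L ^ n * (n.factorial : ℝ) ^ 2) :
    IsGevreyTwo (leibniz χ z) where
  hasDerivAt n t := by
    rcases lt_or_ge 0 t with ht | ht
    · exact hasDerivAt_leibniz (fun n => hχ.hasDerivAt n t) (fun n => hz n t ht) n
    · rw [leibniz_eq_zero_of_left (fun n => hχ0 n t (by linarith))]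
      refine (hasDerivAt_const t (0 : ℝ)).congr_of_eventuallyEq ?_
      filter_upwards [Iio_mem_nhds (show t < t₁ by linarith)] with s hs
      exact leibniz_eq_zero_of_left (fun n => hχ0 n s (mem_Iio.1 hs).le) n
  bound := by
    obtain ⟨K', L', hL', hb'⟩ := hχ.bound
    have hK' : 0 ≤ K' := by simpa using (abs_nonneg _).trans (hb' 0 0)
    have hK : 0 ≤ K := by simpa using (abs_nonneg _).trans (hb 0 t₁ le_rfl)
    refine ⟨K' * K, L' + L, by linarith, fun n t => ?_⟩
    rcases le_total t₁ t with ht | ht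
    · exact abs_leibniz_le (by linarith) hL (fun n => hb' n t) (fun n => hb n t ht) n
    · rw [leibniz_eq_zero_of_left (fun n => hχ0 n t ht), abs_zero]
      positivity

end Cutoff

/-! ### Superpositions of exponential flows -/

section Superposition

variable {Ω : Type*} {a : ℝ} {M l : Ω → ℂ}

/-- The contribution of the parameter `p` to `∂ₓ^m ∂ₜ^n` of a superposition. -/
noncomputable def kernelTerm (a : ℝ) (M l : Ω → ℂ) (m n : ℕ) (x t : ℝ) (p : Ω) : ℂ :=
  M p * l p ^ n * Complex.exp (l p * t) * eigenfun a (l p) m x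

theorem hasDerivAt_kernelTerm (m n : ℕ) (x t : ℝ) (p : Ω) :
    HasDerivAt (fun t => kernelTerm a M l m n x t p) (kernelTerm a M l m (n + 1) x t p) t := by
  have hlin : HasDerivAt (fun t : ℝ => l p * t) (l p) t := by
    simpa using (Complex.ofRealCLM.hasDerivAt (x := t)).const_mul (l p)
  refine ((hlin.cexp.const_mul (M p * l p ^ n)).mul_const _).congr_deriv ?_
  rw [kernelTerm, pow_succ]
  ring

variable [MeasurableSpace Ω] {μ : Measure Ω}

theorem hasDerivWithinAt_integral {S : Set ℝ} (hS : Convex ℝ S) {f f' : ℝ → Ω → ℂ} {g : Ω → ℝ}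
    (hg : Integrable g μ) (hf : ∀ t ∈ S, Integrable (f t) μ)
    (hd : ∀ p, ∀ t ∈ S, HasDerivWithinAt (fun t => f t p) (f' t p) S t)
    (hb : ∀ᵐ p ∂μ, ∀ t ∈ S, ‖f' t p‖ ≤ g p) {t₀ : ℝ} (ht₀ : t₀ ∈ S) :
    HasDerivWithinAt (fun t => ∫ p, f t p ∂μ) (∫ p, f' t₀ p ∂μ) S t₀ := by
  rw [hasDerivWithinAt_iff_tendsto_slope]
  have hslope : (fun t => ∫ p, slope (fun t => f t p) t₀ t ∂μ) =ᶠ[𝓝[S \ {t₀}] t₀]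
      slope (fun t => ∫ p, f t p ∂μ) t₀ := by
    filter_upwards [self_mem_nhdsWithin] with t ht
    simp only [slope_def_module]
    rw [integral_smul, integral_sub (hf t ht.1) (hf t₀ ht₀)]
  refine Tendsto.congr' hslope (tendsto_integral_filter_of_dominated_convergence g ?_ ?_ hg ?_)
  · filter_upwards [self_mem_nhdsWithin] with t ht
    simp only [slope_def_module]
    exact (((hf t ht.1).sub (hf t₀ ht₀)).smul _).aestronglyMeasurable
  · filter_upwards [self_mem_nhdsWithin] with t ht
    filter_upwards [hb] with p hp
    have hmean := hS.norm_image_sub_le_of_norm_hasDerivWithin_le (hd p) hp ht₀ ht.1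
    rwa [slope_def_module, norm_smul, norm_inv,
      inv_mul_le_iff₀ (norm_pos_iff.2 (sub_ne_zero.2 ht.2)), mul_comm]
  · exact Eventually.of_forall fun p => hasDerivWithinAt_iff_tendsto_slope.1 (hd p t₀ ht₀)

/-- Weights `M` and exponents `l`, with `s` of the size of `‖l‖^(1/3)`, for which the superposition
`∫ M e^{l t} G(x, l)` and all its derivatives converge up to `t = 0`, and its trace at `x = 0` is
analytic in `t > 0`. -/
structure IsKernel (a : ℝ) (μ : Measure Ω) (M l : Ω → ℂ) (s : Ω → ℝ) (Q D η c : ℝ) : Prop where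
  measurable_weight : Measurable M
  measurable_exponent : Measurable l
  const_nonneg : 0 ≤ Q
  one_le : 1 ≤ D
  decay_pos : 0 < η
  exponent_decay_pos : 0 < c
  nonneg : ∀ᵐ p ∂μ, 0 ≤ s p
  weight_le : ∀ᵐ p ∂μ, ∀ m, ∀ x ∈ Icc (-1 : ℝ) 0,
    ‖M p‖ * ‖eigenfun a (l p) m x‖ ≤ (D * (1 + s p)) ^ m * (Q * Real.exp (-(η * s p)))
  exponent_le : ∀ᵐ p ∂μ, ‖l p‖ ≤ s p ^ 3
  re_exponent_le : ∀ᵐ p ∂μ, (l p).re ≤ -(c * s p ^ 3)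
  integrable : Integrable (fun p => Real.exp (-(η / 2 * s p))) μ

/-- `∂ₓ^m ∂ₜ^n` of the superposition with weight `M` of the exponential flows `e^{l t} G(x, l)`. -/
noncomputable def superposition (a : ℝ) (μ : Measure Ω) (M l : Ω → ℂ) (m n : ℕ) (x t : ℝ) : ℝ :=
  (∫ p, kernelTerm a M l m n x t p ∂μ).re

/-- The geometric rate of the derivatives of a superposition. -/
noncomputable def kernelRate (D η : ℝ) : ℝ := 256 * D * (1 + 2 / η) ^ 3

theorem one_add_pow_mul_exp_neg_le {η s : ℝ} (hη : 0 < η) (hs : 0 ≤ s) (k : ℕ) :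
    (1 + s) ^ k * Real.exp (-(η * s))
      ≤ Real.exp (η / 2) * (2 / η) ^ k * k.factorial * Real.exp (-(η / 2 * s)) := by
  have h := pow_mul_exp_neg_le (half_pos hη) (by linarith : 0 ≤ 1 + s) k
  rw [inv_div] at h
  calc (1 + s) ^ k * Real.exp (-(η * s))
      = (1 + s) ^ k * Real.exp (-(η / 2 * (1 + s))) * (Real.exp (η / 2)
          * Real.exp (-(η / 2 * s))) := by
        rw [mul_assoc, ← Real.exp_add, ← Real.exp_add]; congr 2; ring
    _ ≤ (2 / η) ^ k * k.factorial * (Real.exp (η / 2) * Real.exp (-(η / 2 * s))) := by gcongr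
    _ = _ := by ring

theorem one_add_pow_mul_pow_three_le_kernelRate {D η s : ℝ} (hD : 1 ≤ D) (hη : 0 < η) (hs : 0 ≤ s)
    (m n : ℕ) :
    (D * (1 + s)) ^ m * (s ^ 3) ^ n * Real.exp (-(η * s)) ≤ Real.exp (η / 2)
      * kernelRate D η ^ (m + n) * (m.factorial * (n.factorial : ℝ) ^ 3)
      * Real.exp (-(η / 2 * s)) := by
  have hr : 1 ≤ 1 + 2 / η := le_add_of_nonneg_right (by positivity)
  have hratem : D * 2 * (1 + 2 / η) ≤ kernelRate D η := by
    have := le_self_pow₀ hr three_ne_zero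
    unfold kernelRate
    nlinarith [mul_le_mul_of_nonneg_left this (by linarith : 0 ≤ D)]
  have hrate : 0 ≤ kernelRate D η := by unfold kernelRate; positivity
  have hraten : 256 * (1 + 2 / η) ^ 3 ≤ kernelRate D η := by
    have : 0 ≤ (1 + 2 / η) ^ 3 := by positivity
    unfold kernelRate
    nlinarith
  calc (D * (1 + s)) ^ m * (s ^ 3) ^ n * Real.exp (-(η * s))
      ≤ (D * (1 + s)) ^ m * ((1 + s) ^ 3) ^ n * Real.exp (-(η * s)) := by
        gcongr
        linarith
    _ = D ^ m * ((1 + s) ^ (m + 3 * n) * Real.exp (-(η * s))) := by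
        rw [mul_pow, pow_add, pow_mul]; ring
    _ ≤ D ^ m * (Real.exp (η / 2) * (1 + 2 / η) ^ (m + 3 * n)
          * (2 ^ (m + 3 * n) * (m.factorial * (32 ^ n * (n.factorial : ℝ) ^ 3)))
          * Real.exp (-(η / 2 * s))) := by
        gcongr ?_ * ?_
        refine (one_add_pow_mul_exp_neg_le hη hs _).trans ?_
        gcongr
        · linarith
        · exact (factorial_add_le m (3 * n)).trans (by gcongr; exact factorial_three_mul_le n)
    _ = Real.exp (η / 2) * ((D * 2 * (1 + 2 / η)) ^ m * (256 * (1 + 2 / η) ^ 3) ^ n)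
          * (m.factorial * (n.factorial : ℝ) ^ 3) * Real.exp (-(η / 2 * s)) := by
        rw [show (256 : ℝ) = 2 ^ 3 * 32 by norm_num, pow_add, pow_add, pow_mul, pow_mul]
        simp only [mul_pow]
        ring
    _ ≤ Real.exp (η / 2) * (kernelRate D η ^ m * kernelRate D η ^ n)
          * (m.factorial * (n.factorial : ℝ) ^ 3) * Real.exp (-(η / 2 * s)) := by gcongr
    _ = _ := by rw [pow_add]

theorem norm_pow_mul_norm_cexp_le {l : ℂ} {v c t₁ t : ℝ} (hv : 0 ≤ v) (hc : 0 < c) (ht₁ : 0 < t₁)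
    (ht : t₁ ≤ t) (hl : ‖l‖ ≤ v) (hre : l.re ≤ -(c * v)) (n : ℕ) :
    ‖l‖ ^ n * ‖Complex.exp (l * t)‖ ≤ (c * t₁)⁻¹ ^ n * n.factorial := by
  have hexp : l.re * t ≤ -(c * t₁ * v) := by nlinarith [mul_nonneg hc.le hv]
  rw [Complex.norm_exp, Complex.re_mul_ofReal]
  exact le_trans (by gcongr) (pow_mul_exp_neg_le (mul_pos hc ht₁) hv n)

namespace IsKernel

variable {s : Ω → ℝ} {Q D η c : ℝ}

theorem norm_kernelTerm_le (h : IsKernel a μ M l s Q D η c) : ∀ᵐ p ∂μ, ∀ m n, ∀ x ∈ Icc (-1 : ℝ) 0,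
    ∀ t, 0 ≤ t → ‖kernelTerm a M l m n x t p‖ ≤ Q * Real.exp (η / 2) * kernelRate D η ^ (m + n)
      * (m.factorial * (n.factorial : ℝ) ^ 3) * Real.exp (-(η / 2 * s p)) := by
  filter_upwards [h.nonneg, h.weight_le, h.exponent_le, h.re_exponent_le]
    with p hs hM hl hre m n x hx t ht
  have hQ := h.const_nonneg
  have hexp : ‖Complex.exp (l p * t)‖ ≤ 1 := by
    rw [Complex.norm_exp, Complex.re_mul_ofReal]
    have hcs : 0 ≤ c * s p ^ 3 := mul_nonneg h.exponent_decay_pos.le (by positivity)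
    exact Real.exp_le_one_iff.2 (mul_nonpos_of_nonpos_of_nonneg (by linarith) ht)
  rw [kernelTerm, norm_mul, norm_mul, norm_mul, norm_pow]
  calc ‖M p‖ * ‖l p‖ ^ n * ‖Complex.exp (l p * t)‖ * ‖eigenfun a (l p) m x‖
      = (‖M p‖ * ‖eigenfun a (l p) m x‖) * ‖l p‖ ^ n * ‖Complex.exp (l p * t)‖ := by ring
    _ ≤ ((D * (1 + s p)) ^ m * (Q * Real.exp (-(η * s p)))) * (s p ^ 3) ^ n * 1 := by
        have := h.one_le
        gcongr ?_ * ?_ ^ n * ?_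
        exact hM m x hx
    _ = Q * ((D * (1 + s p)) ^ m * (s p ^ 3) ^ n * Real.exp (-(η * s p))) := by ring
    _ ≤ _ := by
        refine (mul_le_mul_of_nonneg_left
          (one_add_pow_mul_pow_three_le_kernelRate h.one_le h.decay_pos hs m n) hQ).trans_eq ?_
        ring

theorem integrable_kernelTerm (h : IsKernel a μ M l s Q D η c) (m n : ℕ) {x : ℝ}
    (hx : x ∈ Icc (-1 : ℝ) 0) {t : ℝ} (ht : 0 ≤ t) : Integrable (kernelTerm a M l m n x t) μ := by
  have hM := h.measurable_weight
  have hl := h.measurable_exponent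
  have hG : Measurable fun p => eigenfun a (l p) m x :=
    (measurable_eigenfun (abs_lt_two_of_mem hx).le m).comp hl
  have hmeas : Measurable (kernelTerm a M l m n x t) := by
    unfold kernelTerm
    fun_prop
  exact (h.integrable.const_mul _).mono' hmeas.aestronglyMeasurable
    (h.norm_kernelTerm_le.mono fun _ hp => hp m n x hx t ht)

theorem isDerivSeq_superposition_x (h : IsKernel a μ M l s Q D η c) (n : ℕ) {t : ℝ} (ht : 0 ≤ t) :
    IsDerivSeq (Icc (-1) 0) fun m x => superposition a μ M l m n x t := fun m x hx =>
  Complex.reCLM.hasFDerivAt.comp_hasDerivWithinAt x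
    (hasDerivWithinAt_integral (convex_Icc (-1 : ℝ) 0) (h.integrable.const_mul _)
      (f := fun x => kernelTerm a M l m n x t) (f' := fun x => kernelTerm a M l (m + 1) n x t)
      (fun _ hx => h.integrable_kernelTerm m n hx ht)
      (fun _ _ hx =>
        ((hasDerivAt_eigenfun (abs_lt_two_of_mem hx) m).const_mul _).hasDerivWithinAt)
      (h.norm_kernelTerm_le.mono fun _ hp x hx => hp (m + 1) n x hx t ht) hx)

theorem isDerivSeq_superposition_t (h : IsKernel a μ M l s Q D η c) (m : ℕ) {x : ℝ}
    (hx : x ∈ Icc (-1 : ℝ) 0) :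
    IsDerivSeq (Ici 0) fun n t => superposition a μ M l m n x t := fun n t ht =>
  Complex.reCLM.hasFDerivAt.comp_hasDerivWithinAt t
    (hasDerivWithinAt_integral (convex_Ici (0 : ℝ)) (h.integrable.const_mul _)
      (f := fun t => kernelTerm a M l m n x t) (f' := fun t => kernelTerm a M l m (n + 1) x t)
      (fun _ ht => h.integrable_kernelTerm m n hx ht)
      (fun p t _ => (hasDerivAt_kernelTerm m n x t p).hasDerivWithinAt)
      (h.norm_kernelTerm_le.mono fun _ hp t ht => hp m (n + 1) x hx t ht) ht)

theorem superposition_add_three (h : IsKernel a μ M l s Q D η c) (m n : ℕ) {x : ℝ}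
    (hx : x ∈ Icc (-1 : ℝ) 0) {t : ℝ} (ht : 0 ≤ t) :
    superposition a μ M l (m + 3) n x t + a * superposition a μ M l (m + 1) n x t
      = superposition a μ M l m (n + 1) x t := by
  unfold superposition
  rw [← Complex.re_ofReal_mul, ← Complex.add_re, ← integral_const_mul,
    ← integral_add (h.integrable_kernelTerm (m + 3) n hx ht)
      ((h.integrable_kernelTerm (m + 1) n hx ht).const_mul _)]
  congr 2 with p
  simp only [kernelTerm, eigenfun_add_three (abs_lt_two_of_mem hx).le]
  ring

theorem abs_superposition_le (h : IsKernel a μ M l s Q D η c) (m n : ℕ) {x : ℝ}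
    (hx : x ∈ Icc (-1 : ℝ) 0) {t : ℝ} (ht : 0 ≤ t) :
    |superposition a μ M l m n x t| ≤ Q * Real.exp (η / 2) * (∫ p, Real.exp (-(η / 2 * s p)) ∂μ)
      * kernelRate D η ^ (m + n) * (m.factorial * (n.factorial : ℝ) ^ 3) := by
  refine (Complex.abs_re_le_norm _).trans ((norm_integral_le_of_norm_le
    (h.integrable.const_mul _)
    (h.norm_kernelTerm_le.mono fun p hp => hp m n x hx t ht)).trans_eq ?_)
  rw [integral_const_mul]
  ring

theorem isFlow_superposition (h : IsKernel a μ M l s Q D η c) :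
    IsFlow a (Ici 0) (superposition a μ M l) where
  derivSeq_x n _ ht := h.isDerivSeq_superposition_x n ht
  derivSeq_t m _ hx := h.isDerivSeq_superposition_t m hx
  equation m n _ hx _ ht := h.superposition_add_three m n hx ht
  zero_right n t _ := by simp [superposition, kernelTerm, eigenfun_zero_right]
  zero_right_deriv n t _ := by simp [superposition, kernelTerm, eigenfun_one_zero_right]
  bound := by
    have : 0 ≤ ∫ p, Real.exp (-(η / 2 * s p)) ∂μ := integral_nonneg fun p => (Real.exp_pos _).le
    have hQ := h.const_nonneg
    have hη := h.decay_pos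
    have hD := h.one_le
    have hrate : 0 < kernelRate D η := by unfold kernelRate; positivity
    refine ⟨Q * Real.exp (η / 2) * (∫ p, Real.exp (-(η / 2 * s p)) ∂μ) + 1, kernelRate D η,
      by positivity, hrate, fun m n x hx t ht => (h.abs_superposition_le m n hx ht).trans ?_⟩
    gcongr
    linarith

theorem exists_norm_weight_le (h : IsKernel a μ M l s Q D η c) :
    ∃ K, 0 ≤ K ∧ ∀ᵐ p ∂μ, ‖M p‖ ≤ K * Real.exp (-(η / 2 * s p)) := by
  have hQ := h.const_nonneg
  have hη := h.decay_pos
  have hD := h.one_le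
  refine ⟨Q * Real.exp (η / 2) * kernelRate D η ^ 2 * 2, by unfold kernelRate; positivity, ?_⟩
  filter_upwards [h.norm_kernelTerm_le] with p hp
  simpa [kernelTerm, eigenfun_two_zero_right] using hp 2 0 0 (by norm_num) 0 le_rfl

/-- The exponents lie in a sector of the left half plane, so the trace is analytic for `t > 0`. -/
theorem exists_abs_superposition_two_le (h : IsKernel a μ M l s Q D η c) {t₁ : ℝ} (ht₁ : 0 < t₁) :
    ∃ K L : ℝ, 0 ≤ K ∧ 0 ≤ L ∧ ∀ n t, t₁ ≤ t →
      |superposition a μ M l 2 n 0 t| ≤ K * L ^ n * n.factorial := by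
  obtain ⟨K, hK, hM⟩ := h.exists_norm_weight_le
  have hc := h.exponent_decay_pos
  refine ⟨K * ∫ p, Real.exp (-(η / 2 * s p)) ∂μ, (c * t₁)⁻¹,
    mul_nonneg hK (integral_nonneg fun p => (Real.exp_pos _).le), by positivity, fun n t ht => ?_⟩
  have hterm : ∀ᵐ p ∂μ, ‖kernelTerm a M l 2 n 0 t p‖
      ≤ K * (c * t₁)⁻¹ ^ n * n.factorial * Real.exp (-(η / 2 * s p)) := by
    filter_upwards [hM, h.nonneg, h.exponent_le, h.re_exponent_le] with p hM hs hl hre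
    rw [kernelTerm, eigenfun_two_zero_right, mul_one, norm_mul, norm_mul, norm_pow, mul_assoc]
    calc ‖M p‖ * (‖l p‖ ^ n * ‖Complex.exp (l p * t)‖)
        ≤ K * Real.exp (-(η / 2 * s p)) * ((c * t₁)⁻¹ ^ n * n.factorial) := by
          gcongr ?_ * ?_
          exact norm_pow_mul_norm_cexp_le (by positivity) hc ht₁ ht hl hre n
      _ = _ := by ring
  refine (Complex.abs_re_le_norm _).trans ((norm_integral_le_of_norm_le
    (h.integrable.const_mul _) hterm).trans_eq ?_)
  rw [integral_const_mul]
  ring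

end IsKernel

end Superposition

/-! ### Borel sums over rays -/

section LaplaceMoment

variable {r : ℂ}

theorem norm_pow_mul_exp_neg_mul_le (hr : 0 < r.re) (k : ℕ) {t : ℝ} (ht : 0 ≤ t) :
    ‖(t : ℂ) ^ k * Complex.exp (-(r * t))‖
      ≤ Real.exp (r.re / 2) * (2 / r.re) ^ k * k.factorial * Real.exp (-(r.re / 2 * t)) := by
  rw [norm_mul, norm_pow, Complex.norm_of_nonneg ht, Complex.norm_exp, Complex.neg_re,
    Complex.re_mul_ofReal]
  refine le_trans ?_ (one_add_pow_mul_exp_neg_le hr ht k)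
  gcongr
  linarith

theorem integrableOn_pow_mul_exp_neg_mul_Ioi (hr : 0 < r.re) (k : ℕ) :
    IntegrableOn (fun t : ℝ => (t : ℂ) ^ k * Complex.exp (-(r * t))) (Ioi 0) := by
  have hexp := integrableOn_exp_mul_Ioi (neg_lt_zero.2 (half_pos hr)) 0
  simp only [neg_mul] at hexp
  refine (hexp.const_mul (Real.exp (r.re / 2) * (2 / r.re) ^ k * k.factorial)).mono'
    (by fun_prop) ?_
  filter_upwards [ae_restrict_mem measurableSet_Ioi] with t ht
  exact norm_pow_mul_exp_neg_mul_le hr k (mem_Ioi.1 ht).le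

theorem tendsto_pow_mul_exp_neg_mul_atTop (hr : 0 < r.re) (k : ℕ) :
    Tendsto (fun t : ℝ => (t : ℂ) ^ k * Complex.exp (-(r * t))) atTop (𝓝 0) := by
  refine squeeze_zero_norm' ((eventually_ge_atTop 0).mono
    fun t ht => norm_pow_mul_exp_neg_mul_le hr k ht) ?_
  have hexp : Tendsto (fun t => Real.exp (-(r.re / 2 * t))) atTop (𝓝 0) :=
    Real.tendsto_exp_neg_atTop_nhds_zero.comp (tendsto_id.const_mul_atTop (half_pos hr))
  simpa only [mul_zero] using hexp.const_mul (Real.exp (r.re / 2) * (2 / r.re) ^ k * k.factorial)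

theorem integral_pow_succ_mul_exp_neg_mul_Ioi (hr : 0 < r.re) (k : ℕ) :
    r * ∫ t : ℝ in Ioi 0, (t : ℂ) ^ (k + 1) * Complex.exp (-(r * t))
      = (k + 1) * ∫ t : ℝ in Ioi 0, (t : ℂ) ^ k * Complex.exp (-(r * t)) := by
  have hderiv (t : ℝ) : HasDerivAt (fun t : ℝ => (t : ℂ) ^ (k + 1) * Complex.exp (-(r * t)))
      ((k + 1) * ((t : ℂ) ^ k * Complex.exp (-(r * t)))
        - r * ((t : ℂ) ^ (k + 1) * Complex.exp (-(r * t)))) t := by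
    have hpow := hasDerivAt_pow (k + 1) (t : ℂ)
    have hexp : HasDerivAt (fun z : ℂ => Complex.exp (-(r * z)))
        (Complex.exp (-(r * t)) * -(r * 1)) t :=
      ((hasDerivAt_id' (t : ℂ)).const_mul r).neg.cexp
    refine (hpow.mul hexp).comp_ofReal.congr_deriv ?_
    push_cast
    ring_nf
  have hint := (integrableOn_pow_mul_exp_neg_mul_Ioi hr k).const_mul ((k : ℂ) + 1)
  have hint' := (integrableOn_pow_mul_exp_neg_mul_Ioi hr (k + 1)).const_mul r
  have h := integral_Ioi_of_hasDerivAt_of_tendsto' (fun t _ => hderiv t) (hint.sub hint')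
    (tendsto_pow_mul_exp_neg_mul_atTop hr (k + 1))
  rw [integral_sub hint hint', integral_const_mul, integral_const_mul, Complex.ofReal_zero,
    zero_pow k.succ_ne_zero, zero_mul, sub_zero] at h
  exact (sub_eq_zero.1 h).symm

theorem integral_pow_mul_exp_neg_mul_Ioi (hr : 0 < r.re) (k : ℕ) :
    ∫ t : ℝ in Ioi 0, (t : ℂ) ^ k * Complex.exp (-(r * t)) = k.factorial / r ^ (k + 1) := by
  have hne : r ≠ 0 := by
    rintro rfl
    exact hr.ne rfl
  induction k with
  | zero =>
    have h := integral_exp_mul_complex_Ioi (a := -r) (by simpa using hr) 0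
    simpa [neg_div_neg_eq] using h
  | succ k ih =>
    have h := integral_pow_succ_mul_exp_neg_mul_Ioi hr k
    rw [ih] at h
    rw [Nat.factorial_succ, pow_succ r (k + 1), eq_div_iff (by positivity), mul_comm, mul_assoc, h]
    push_cast
    field_simp

end LaplaceMoment

theorem integral_exp_int_mul_I (j : ℤ) :
    ∫ θ in -Real.pi..Real.pi, Complex.exp (j * θ * Complex.I)
      = if j = 0 then 2 * Real.pi else 0 := by
  split_ifs with hj
  · simp [hj]
    ring
  · have hc : (j : ℂ) * Complex.I ≠ 0 := mul_ne_zero (by exact_mod_cast hj) Complex.I_ne_zero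
    have hperiod : Complex.exp (j * Complex.I * Real.pi)
        = Complex.exp (j * Complex.I * (-Real.pi : ℝ)) := by
      rw [Complex.exp_eq_exp_iff_exists_int]
      exact ⟨j, by push_cast; ring⟩
    simp only [mul_right_comm _ _ Complex.I]
    rw [integral_exp_mul_complex hc, hperiod, sub_self, zero_div]
    simp

section CircleSeries

/-- The function on the circle with Fourier coefficients `bₖ` at `-k`. -/
noncomputable def circleSeries (b : ℕ → ℝ) (θ : ℝ) : ℂ :=
  ∑' k : ℕ, (b k : ℂ) * Complex.exp (-(k * θ * Complex.I))

variable {b : ℕ → ℝ}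

theorem norm_exp_natCast_mul_I (n : ℕ) (θ : ℝ) : ‖Complex.exp (n * θ * Complex.I)‖ = 1 := by
  exact_mod_cast Complex.norm_exp_ofReal_mul_I (n * θ)

theorem norm_circleSeries_term (k : ℕ) (θ : ℝ) :
    ‖(b k : ℂ) * Complex.exp (-(k * θ * Complex.I))‖ = |b k| := by
  rw [norm_mul, Complex.norm_real, Real.norm_eq_abs, Complex.exp_neg, norm_inv,
    norm_exp_natCast_mul_I, inv_one, mul_one]

theorem continuous_circleSeries (hb : Summable fun k => |b k|) : Continuous (circleSeries b) :=
  continuous_tsum (fun k => by fun_prop) hb fun k θ => (norm_circleSeries_term k θ).le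

theorem norm_circleSeries_le (hb : Summable fun k => |b k|) (θ : ℝ) :
    ‖circleSeries b θ‖ ≤ ∑' k, |b k| :=
  tsum_of_norm_bounded hb.hasSum fun k => (norm_circleSeries_term k θ).le

theorem integral_circleSeries (hb : Summable fun k => |b k|) (n : ℕ) :
    ∫ θ in -Real.pi..Real.pi, circleSeries b θ * Complex.exp (n * θ * Complex.I)
      = 2 * Real.pi * b n := by
  have hterm (k : ℕ) : ∫ θ in -Real.pi..Real.pi, (b k : ℂ) * Complex.exp (-(k * θ * Complex.I))
      * Complex.exp (n * θ * Complex.I) = if k = n then (2 * Real.pi * b n : ℂ) else 0 := by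
    have hshift (θ : ℝ) : (b k : ℂ) * Complex.exp (-(k * θ * Complex.I))
        * Complex.exp (n * θ * Complex.I)
        = b k * Complex.exp (((n - k : ℤ) : ℂ) * θ * Complex.I) := by
      rw [mul_assoc, ← Complex.exp_add]
      push_cast
      ring_nf
    simp only [hshift]
    rw [intervalIntegral.integral_const_mul, integral_exp_int_mul_I]
    split_ifs with h₁ h₂ h₂
    · rw [h₂]
      push_cast
      ring
    · omega
    · omega
    · simp
  have hsum := intervalIntegral.hasSum_integral_of_dominated_convergence (μ := volume)
    (a := -Real.pi) (b := Real.pi)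
    (F := fun (k : ℕ) (θ : ℝ) => (b k : ℂ) * Complex.exp (-(k * θ * Complex.I))
      * Complex.exp (n * θ * Complex.I))
    (f := fun θ => circleSeries b θ * Complex.exp (n * θ * Complex.I))
    (fun k _ => |b k|) (fun k => by fun_prop)
    (fun k => Eventually.of_forall fun θ _ => by
      rw [norm_mul, norm_circleSeries_term, norm_exp_natCast_mul_I, mul_one])
    (Eventually.of_forall fun _ _ => hb) intervalIntegrable_const
    (Eventually.of_forall fun θ _ => (Summable.of_norm_bounded hb fun k =>
      (norm_circleSeries_term k θ).le).hasSum.mul_right _)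
  simp only [hterm] at hsum
  exact hsum.unique (hasSum_ite_eq n _)

end CircleSeries

section Ray

/-- The argument of the ray belonging to the angle `θ ∈ (-π, π]`: it makes `θ + 3 * rayAngle δ θ`
equal to `±(π/2 + δ)`, slightly inside the left half plane, and lies between `±(π/6 + δ/3)`. -/
noncomputable def rayAngle (δ θ : ℝ) : ℝ :=
  if 0 ≤ θ then (Real.pi / 2 + δ - θ) / 3 else (-(Real.pi / 2 + δ) - θ) / 3

/-- The direction of the ray belonging to the angle `θ`. -/
noncomputable def rayDir (δ θ : ℝ) : ℂ := Complex.exp (rayAngle δ θ * Complex.I)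

/-- The parameters of the superposition: an angle and a position on the ray belonging to it. -/
noncomputable def rayMeasure : Measure (ℝ × ℝ) :=
  (volume.restrict (Ioc (-Real.pi) Real.pi)).prod (volume.restrict (Ioi 0))

/-- The exponent `κ³ e^{iθ} ζ³` at the point `ζ` of the ray belonging to `θ`. -/
noncomputable def rayExponent (δ κ : ℝ) (p : ℝ × ℝ) : ℂ :=
  κ ^ 3 * Complex.exp (p.1 * Complex.I) * (rayDir δ p.1 * p.2) ^ 3

/-- The weight of the superposition: the Borel kernel `ζ^N e^{-ζ} dζ` on the ray belonging to `θ`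
times the function of `θ` with Fourier coefficients `bₖ`. -/
noncomputable def rayWeight (δ : ℝ) (b : ℕ → ℝ) (N : ℕ) (p : ℝ × ℝ) : ℂ :=
  (2 * Real.pi : ℂ)⁻¹ * circleSeries b p.1 * rayDir δ p.1 ^ (N + 1) * (p.2 : ℂ) ^ N
    * Complex.exp (-(rayDir δ p.1 * p.2))

variable {δ κ η θ : ℝ} {p : ℝ × ℝ} {b : ℕ → ℝ}

theorem measurable_rayDir : Measurable (rayDir δ) := by
  have : Measurable (rayAngle δ) :=
    Measurable.ite measurableSet_Ici (by fun_prop) (by fun_prop)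
  unfold rayDir
  fun_prop

theorem norm_rayDir (δ θ : ℝ) : ‖rayDir δ θ‖ = 1 := Complex.norm_exp_ofReal_mul_I _

theorem cos_add_three_mul_rayAngle (δ θ : ℝ) : Real.cos (θ + 3 * rayAngle δ θ) = -Real.sin δ := by
  rw [← Real.cos_add_pi_div_two]
  unfold rayAngle
  split_ifs
  · congr 1
    ring
  · rw [← Real.cos_neg]
    congr 1
    ring

theorem cos_le_re_rayDir (hδ₀ : 0 ≤ δ) (hδ : δ ≤ Real.pi / 2) (hθ : θ ∈ Ioc (-Real.pi) Real.pi) :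
    Real.cos (Real.pi / 6 + δ / 3) ≤ (rayDir δ θ).re := by
  have hangle : |rayAngle δ θ| ≤ Real.pi / 6 + δ / 3 := by
    obtain ⟨h₁, h₂⟩ := hθ
    unfold rayAngle
    split_ifs with h <;> rw [abs_le] <;> constructor <;> linarith
  rw [rayDir, Complex.exp_ofReal_mul_I_re, ← Real.cos_abs (rayAngle δ θ)]
  exact Real.cos_le_cos_of_nonneg_of_le_pi (abs_nonneg _) (by linarith [Real.pi_pos]) hangle

theorem norm_rayExponent (hκ : 0 ≤ κ) (hp : 0 ≤ p.2) : ‖rayExponent δ κ p‖ = (κ * p.2) ^ 3 := by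
  rw [rayExponent, norm_mul, norm_mul, Complex.norm_exp_ofReal_mul_I, norm_pow, norm_pow, norm_mul,
    norm_rayDir, Complex.norm_of_nonneg hκ, Complex.norm_of_nonneg hp]
  ring

theorem re_rayExponent : (rayExponent δ κ p).re = -(Real.sin δ * κ ^ 3 * p.2 ^ 3) := by
  have h : rayExponent δ κ p = ((κ ^ 3 * p.2 ^ 3 : ℝ) : ℂ)
      * Complex.exp ((p.1 + 3 * rayAngle δ p.1 : ℝ) * Complex.I) := by
    rw [rayExponent, rayDir, mul_pow, ← Complex.exp_nat_mul]
    push_cast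
    rw [add_mul, Complex.exp_add]
    ring_nf
  rw [h, Complex.re_ofReal_mul, Complex.exp_ofReal_mul_I_re, cos_add_three_mul_rayAngle]
  ring

/-- The triple angle formula: `w ↦ 4 w³ - 3 ‖w‖² w` is increasing for `w ≥ ‖w‖ / 2`. -/
theorem re_le_norm_mul_cos {w : ℂ} {β : ℝ} (hβ : 1 / 2 ≤ Real.cos β)
    (hw : (w ^ 3).re ≤ ‖w‖ ^ 3 * Real.cos (3 * β)) : w.re ≤ ‖w‖ * Real.cos β := by
  have hre : (w ^ 3).re = 4 * w.re ^ 3 - 3 * ‖w‖ ^ 2 * w.re := by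
    rw [← Complex.normSq_eq_norm_sq, Complex.normSq_apply, pow_succ, pow_two]
    simp only [Complex.mul_re, Complex.mul_im]
    ring
  rw [hre, Real.cos_three_mul] at hw
  set g := ‖w‖ * Real.cos β with hg
  have hgw : ‖w‖ / 2 ≤ g := by nlinarith [norm_nonneg w]
  by_contra! h
  have hpos : 0 < (w.re - g) * (4 * (w.re ^ 2 + w.re * g + g ^ 2) - 3 * ‖w‖ ^ 2) := by
    refine mul_pos (sub_pos.2 h) ?_
    nlinarith [norm_nonneg w]
  have hcube : ‖w‖ ^ 3 * (4 * Real.cos β ^ 3 - 3 * Real.cos β) = 4 * g ^ 3 - 3 * ‖w‖ ^ 2 * g := by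
    rw [hg]; ring
  nlinarith [hcube]

theorem re_cube_root_rayExponent_le (hδ₀ : 0 ≤ δ) (hδ : δ ≤ Real.pi / 2) (hκ : 0 ≤ κ)
    (hp : 0 ≤ p.2) {w : ℂ} (hw : w ^ 3 = -rayExponent δ κ p) :
    w.re ≤ κ * p.2 * Real.cos (Real.pi / 6 - δ / 3) := by
  have hnorm : ‖w‖ = κ * p.2 := by
    rw [← pow_left_inj₀ (norm_nonneg w) (mul_nonneg hκ hp) three_ne_zero, ← norm_pow, hw, norm_neg,
      norm_rayExponent hκ hp]
  have hcos : 1 / 2 ≤ Real.cos (Real.pi / 6 - δ / 3) := by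
    rw [← Real.cos_pi_div_three]
    exact Real.cos_le_cos_of_nonneg_of_le_pi (by linarith) (by linarith [Real.pi_pos])
      (by linarith [Real.pi_pos])
  rw [← hnorm]
  refine re_le_norm_mul_cos hcos (le_of_eq ?_)
  rw [hw, Complex.neg_re, re_rayExponent, hnorm,
    show 3 * (Real.pi / 6 - δ / 3) = Real.pi / 2 - δ by ring, Real.cos_pi_div_two_sub]
  ring

theorem norm_rayWeight_le (hb : Summable fun k => |b k|) (N : ℕ) (hp : 0 ≤ p.2) :
    ‖rayWeight δ b N p‖
      ≤ (∑' k, |b k|) * (1 + p.2) ^ N * Real.exp (-((rayDir δ p.1).re * p.2)) := by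
  have hpi : ‖(2 * Real.pi : ℂ)⁻¹‖ ≤ 1 := by
    rw [norm_inv, norm_mul, Complex.norm_ofNat, Complex.norm_of_nonneg Real.pi_pos.le]
    exact inv_le_one_of_one_le₀ (by linarith [Real.pi_gt_three])
  have : 0 ≤ ∑' k, |b k| := tsum_nonneg fun _ => abs_nonneg _
  rw [rayWeight, norm_mul, norm_mul, norm_mul, norm_mul, norm_pow, norm_pow, norm_rayDir, one_pow,
    mul_one, Complex.norm_of_nonneg hp, Complex.norm_exp, Complex.neg_re, Complex.re_mul_ofReal]
  gcongr
  · exact (mul_le_of_le_one_left (norm_nonneg _) hpi).trans (norm_circleSeries_le hb _)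
  · linarith

theorem measurable_rayWeight (hb : Summable fun k => |b k|) (N : ℕ) :
    Measurable (rayWeight δ b N) := by
  have hS := (continuous_circleSeries hb).measurable
  have hω := measurable_rayDir (δ := δ)
  unfold rayWeight
  fun_prop

theorem measurable_rayExponent : Measurable (rayExponent δ κ) := by
  have hω := measurable_rayDir (δ := δ)
  unfold rayExponent
  fun_prop

theorem ae_mem_rayMeasure :
    ∀ᵐ p ∂rayMeasure, p.1 ∈ Ioc (-Real.pi) Real.pi ∧ 0 ≤ p.2 := by
  rw [rayMeasure, Measure.prod_restrict]
  filter_upwards [ae_restrict_mem (measurableSet_Ioc.prod measurableSet_Ioi)] with p hp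
  exact ⟨hp.1, (mem_Ioi.1 hp.2).le⟩

theorem integrable_exp_rayMeasure {c : ℝ} (hc : 0 < c) :
    Integrable (fun p : ℝ × ℝ => Real.exp (-(c * p.2))) rayMeasure := by
  have h := integrableOn_exp_mul_Ioi (neg_lt_zero.2 hc) 0
  simp only [neg_mul] at h
  exact h.comp_snd _

theorem norm_rayWeight_mul_norm_eigenfun_le {a Q : ℝ} {m : ℕ} {x : ℝ} (hη : 0 < η) (hQ : 0 ≤ Q)
    (hgap : κ * Real.cos (Real.pi / 6 - δ / 3) + η ≤ (rayDir δ p.1).re)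
    (hb : Summable fun k => |b k|) (N : ℕ) (hp : 0 ≤ p.2)
    (hG : ‖eigenfun a (rayExponent δ κ p) m x‖ ≤ ((1 + |a|) * (1 + p.2)) ^ m
      * (Q * Real.exp (κ * p.2 * Real.cos (Real.pi / 6 - δ / 3)))) :
    ‖rayWeight δ b N p‖ * ‖eigenfun a (rayExponent δ κ p) m x‖ ≤ ((1 + |a|) * (1 + p.2)) ^ m
      * ((∑' k, |b k|) * Q * (Real.exp (η / 2) * (2 / η) ^ N * N.factorial)
        * Real.exp (-(η / 2 * p.2))) := by
  have : 0 ≤ ∑' k, |b k| := tsum_nonneg fun _ => abs_nonneg _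
  have hexp : Real.exp (-((rayDir δ p.1).re * p.2))
      * Real.exp (κ * p.2 * Real.cos (Real.pi / 6 - δ / 3)) ≤ Real.exp (-(η * p.2)) := by
    rw [← Real.exp_add, Real.exp_le_exp]
    nlinarith
  calc ‖rayWeight δ b N p‖ * ‖eigenfun a (rayExponent δ κ p) m x‖
      ≤ ((∑' k, |b k|) * (1 + p.2) ^ N * Real.exp (-((rayDir δ p.1).re * p.2)))
        * (((1 + |a|) * (1 + p.2)) ^ m
          * (Q * Real.exp (κ * p.2 * Real.cos (Real.pi / 6 - δ / 3)))) := by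
        gcongr
        exact norm_rayWeight_le hb N hp
    _ = ((1 + |a|) * (1 + p.2)) ^ m * ((∑' k, |b k|) * Q * ((1 + p.2) ^ N
        * (Real.exp (-((rayDir δ p.1).re * p.2))
          * Real.exp (κ * p.2 * Real.cos (Real.pi / 6 - δ / 3))))) := by ring
    _ ≤ ((1 + |a|) * (1 + p.2)) ^ m * ((∑' k, |b k|) * Q * ((1 + p.2) ^ N
        * Real.exp (-(η * p.2)))) := by gcongr
    _ ≤ ((1 + |a|) * (1 + p.2)) ^ m * ((∑' k, |b k|) * Q * (Real.exp (η / 2) * (2 / η) ^ N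
        * N.factorial * Real.exp (-(η / 2 * p.2)))) := by
        gcongr ?_ * (?_ * ?_)
        exact one_add_pow_mul_exp_neg_le hη hp N
    _ = _ := by ring

theorem exists_isKernel_ray (a : ℝ) (hδ₀ : 0 < δ) (hδ : δ ≤ Real.pi / 2) (hκ₀ : 0 < κ) (hκ : κ ≤ 1)
    (hη : 0 < η)
    (hgap : κ * Real.cos (Real.pi / 6 - δ / 3) + η ≤ Real.cos (Real.pi / 6 + δ / 3))
    (hb : Summable fun k => |b k|) (N : ℕ) :
    ∃ Q, IsKernel a rayMeasure (rayWeight δ b N) (rayExponent δ κ) Prod.snd Q (1 + |a|) (η / 2)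
      (Real.sin δ * κ ^ 3) := by
  obtain ⟨Q, hQ, hG⟩ := exists_norm_eigenfun_le a
  have hcos : 0 ≤ Real.cos (Real.pi / 6 - δ / 3) :=
    Real.cos_nonneg_of_neg_pi_div_two_le_of_le (by linarith [Real.pi_pos])
      (by linarith [Real.pi_pos])
  refine ⟨(∑' k, |b k|) * Q * (Real.exp (η / 2) * (2 / η) ^ N * N.factorial),
    measurable_rayWeight hb N, measurable_rayExponent,
    mul_nonneg (mul_nonneg (tsum_nonneg fun _ => abs_nonneg _) hQ.le) (by positivity),
    le_add_of_nonneg_right (abs_nonneg a), half_pos hη,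
    mul_pos (Real.sin_pos_of_pos_of_lt_pi hδ₀ (by linarith [Real.pi_pos])) (by positivity),
    ae_mem_rayMeasure.mono fun p hp => hp.2, ?_, ?_,
    Eventually.of_forall fun p => re_rayExponent.le, integrable_exp_rayMeasure (by positivity)⟩
  · filter_upwards [ae_mem_rayMeasure] with p ⟨hθ, hp⟩ m x hx
    refine norm_rayWeight_mul_norm_eigenfun_le hη hQ.le
      (hgap.trans (cos_le_re_rayDir hδ₀.le hδ hθ)) hb N hp (hG _ p.2 _ hp (by positivity) ?_
        (fun w hw => re_cube_root_rayExponent_le hδ₀.le hδ hκ₀.le hp hw) m x hx)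
    rw [norm_rayExponent hκ₀.le hp]
    gcongr
    exact mul_le_of_le_one_left hp hκ
  · filter_upwards [ae_mem_rayMeasure] with p hp
    rw [norm_rayExponent hκ₀.le hp.2]
    exact pow_le_pow_left₀ (mul_nonneg hκ₀.le hp.2) (mul_le_of_le_one_left hp.2 hκ) 3

theorem integral_kernelTerm_ray_snd (a : ℝ) (hθ : 0 < (rayDir δ θ).re) (N n : ℕ) :
    ∫ σ in Ioi (0 : ℝ), kernelTerm a (rayWeight δ b N) (rayExponent δ κ) 2 n 0 0 (θ, σ)
      = ((2 * Real.pi : ℂ)⁻¹ * (κ ^ 3) ^ n * (3 * n + N).factorial)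
        * (circleSeries b θ * Complex.exp (n * θ * Complex.I)) := by
  have hne : rayDir δ θ ≠ 0 := by
    rintro h
    simp [h] at hθ
  have hterm (σ : ℝ) : kernelTerm a (rayWeight δ b N) (rayExponent δ κ) 2 n 0 0 (θ, σ)
      = ((2 * Real.pi : ℂ)⁻¹ * (κ ^ 3) ^ n * circleSeries b θ * Complex.exp (n * θ * Complex.I)
          * rayDir δ θ ^ (3 * n + N + 1))
        * ((σ : ℂ) ^ (3 * n + N) * Complex.exp (-(rayDir δ θ * σ))) := by
    simp only [kernelTerm, rayWeight, rayExponent, eigenfun_two_zero_right, Complex.ofReal_zero,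
      mul_zero, Complex.exp_zero, mul_one]
    rw [mul_assoc (n : ℂ), Complex.exp_nat_mul, mul_pow, mul_pow, mul_pow]
    ring
  simp only [hterm]
  rw [integral_const_mul, integral_pow_mul_exp_neg_mul_Ioi hθ]
  field_simp

theorem integral_kernelTerm_ray {a : ℝ} (hδ₀ : 0 ≤ δ) (hδ : δ ≤ Real.pi / 2)
    (hcos : 0 < Real.cos (Real.pi / 6 + δ / 3)) (hb : Summable fun k => |b k|) (N n : ℕ)
    (hint : Integrable (kernelTerm a (rayWeight δ b N) (rayExponent δ κ) 2 n 0 0) rayMeasure) :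
    ∫ p, kernelTerm a (rayWeight δ b N) (rayExponent δ κ) 2 n 0 0 p ∂rayMeasure
      = ((b n * ((κ ^ 3) ^ n * (3 * n + N).factorial) : ℝ) : ℂ) := by
  unfold rayMeasure at hint ⊢
  rw [integral_prod _ hint, setIntegral_congr_fun measurableSet_Ioc fun θ hθ =>
      integral_kernelTerm_ray_snd a (hcos.trans_le (cos_le_re_rayDir hδ₀ hδ hθ)) N n,
    integral_const_mul, ← intervalIntegral.integral_of_le (by linarith [Real.pi_pos]),
    integral_circleSeries hb]
  have : (Real.pi : ℂ) ≠ 0 := by exact_mod_cast Real.pi_ne_zero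
  push_cast
  field_simp

theorem exists_ray_gap (hκ : κ < 1) : ∃ δ η, 0 < δ ∧ δ ≤ Real.pi / 2 ∧ 0 < η ∧
    κ * Real.cos (Real.pi / 6 - δ / 3) + η ≤ Real.cos (Real.pi / 6 + δ / 3) := by
  have hcont : ContinuousAt (fun δ => Real.cos (Real.pi / 6 + δ / 3)
      - κ * Real.cos (Real.pi / 6 - δ / 3)) 0 := by fun_prop
  have hzero : 0 < Real.cos (Real.pi / 6 + 0 / 3) - κ * Real.cos (Real.pi / 6 - 0 / 3) := by
    have hcos : 0 < Real.cos (Real.pi / 6) := by rw [Real.cos_pi_div_six]; positivity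
    rw [zero_div, add_zero, sub_zero]
    nlinarith
  have hpos : ∀ᶠ δ in 𝓝[>] (0 : ℝ), 0 < Real.cos (Real.pi / 6 + δ / 3)
      - κ * Real.cos (Real.pi / 6 - δ / 3) :=
    (hcont.eventually (lt_mem_nhds hzero)).filter_mono nhdsWithin_le_nhds
  obtain ⟨δ, hδ, hδ₀, hδ'⟩ :=
    (hpos.and (Ioc_mem_nhdsGT (by positivity : 0 < Real.pi / 2))).exists
  exact ⟨δ, _, hδ₀, hδ', hδ, by linarith⟩

theorem exists_flow_of_trace_derivatives (a : ℝ) {d : ℕ → ℝ} {C q : ℝ} {N : ℕ} (hq₀ : 0 ≤ q)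
    (hq : q < 1) (hd : ∀ n, |d n| ≤ C * q ^ n * (3 * n + N).factorial) :
    ∃ Y, IsFlow a (Ici 0) Y ∧ (∀ n, Y 2 n 0 0 = d n) ∧ ∀ t₁ > 0, ∃ K L : ℝ, 0 ≤ K ∧ 0 ≤ L ∧
      ∀ n t, t₁ ≤ t → |Y 2 n 0 t| ≤ K * L ^ n * n.factorial := by
  obtain ⟨κ, hκ₀, hκ, hqκ⟩ : ∃ κ : ℝ, 0 < κ ∧ κ < 1 ∧ q < κ ^ 3 :=
    ⟨(3 + q) / 4, by linarith, by linarith, by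
      nlinarith [sq_nonneg (q - 1), mul_nonneg hq₀ (sq_nonneg (q - 1))]⟩
  obtain ⟨δ, η, hδ₀, hδ, hη, hgap⟩ := exists_ray_gap hκ
  set b : ℕ → ℝ := fun n => d n / ((κ ^ 3) ^ n * (3 * n + N).factorial) with hbdef
  have hb : Summable fun k => |b k| := by
    refine Summable.of_nonneg_of_le (fun _ => abs_nonneg _) (fun n => ?_)
      ((summable_geometric_of_lt_one (by positivity)
        ((div_lt_one (by positivity)).2 hqκ)).mul_left C)
    rw [hbdef, abs_div, abs_of_pos (by positivity : 0 < (κ ^ 3) ^ n * ((3 * n + N).factorial : ℝ)),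
      div_le_iff₀ (by positivity), div_pow]
    refine (hd n).trans_eq ?_
    field_simp
  obtain ⟨Q, hker⟩ := exists_isKernel_ray a hδ₀ hδ hκ₀ hκ.le hη hgap hb N
  have hcos : 0 < Real.cos (Real.pi / 6 + δ / 3) := by
    have : 0 ≤ Real.cos (Real.pi / 6 - δ / 3) :=
      Real.cos_nonneg_of_neg_pi_div_two_le_of_le (by linarith [Real.pi_pos])
        (by linarith [Real.pi_pos])
    nlinarith
  refine ⟨_, hker.isFlow_superposition, fun n => ?_,
    fun t₁ ht₁ => hker.exists_abs_superposition_two_le ht₁⟩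
  rw [superposition, integral_kernelTerm_ray hδ₀.le hδ hcos hb N n
    (hker.integrable_kernelTerm 2 n (by norm_num) le_rfl), Complex.ofReal_re]
  exact div_mul_cancel₀ _ (by positivity)

end Ray

/-! ### Iterates of `P` on analytic functions -/

section Holomorphic

variable {z : ℂ → ℂ} {r R : ℝ}

theorem isDerivSeq_re_iteratedDeriv {U : Set ℂ} {s : Set ℝ} (hU : IsOpen U)
    (hz : DifferentiableOn ℂ z U) (hs : ∀ x ∈ s, (x : ℂ) ∈ U) :
    IsDerivSeq s (fun m x => (iteratedDeriv m z x).re) := fun m x hx =>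
  (hasDerivAt_iteratedDeriv (hz.analyticAt (hU.mem_nhds (hs x hx)))
    m).real_of_complex.hasDerivWithinAt

theorem exists_norm_iteratedDeriv_le (hr : 0 ≤ r) (hrR : r < R)
    (hz : DifferentiableOn ℂ z (Metric.ball 0 R)) :
    ∃ M, 0 ≤ M ∧ ∀ (m : ℕ) (c : ℂ) (δ : ℝ), 0 < δ → ‖c‖ + δ ≤ r →
      ‖iteratedDeriv m z c‖ ≤ M * δ⁻¹ ^ m * m.factorial := by
  have hball : Metric.closedBall (0 : ℂ) r ⊆ Metric.ball 0 R := Metric.closedBall_subset_ball hrR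
  obtain ⟨M, hM⟩ := (isCompact_closedBall (0 : ℂ) r).exists_bound_of_continuousOn
    (hz.continuousOn.mono hball)
  refine ⟨M, (norm_nonneg _).trans (hM 0 (Metric.mem_closedBall_self hr)), fun m c δ hδ hc => ?_⟩
  have hsub : Metric.closedBall c δ ⊆ Metric.closedBall 0 r :=
    Metric.closedBall_subset_closedBall' (by rw [dist_zero_right]; linarith)
  have hdiff : DiffContOnCl ℂ z (Metric.ball c δ) := by
    refine (hz.mono ?_).diffContOnCl
    rw [closure_ball _ hδ.ne']
    exact hsub.trans hball
  refine (Complex.norm_iteratedDeriv_le_of_forall_mem_sphere_norm_le m hδ hdiff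
    fun w hw => hM w (hsub (Metric.sphere_subset_closedBall hw))).trans_eq ?_
  rw [inv_pow, div_eq_mul_inv]
  ring

theorem norm_ofReal_le_one_of_mem {x : ℝ} (hx : x ∈ Icc (-1 : ℝ) 0) : ‖(x : ℂ)‖ ≤ 1 := by
  rw [Complex.norm_real, Real.norm_eq_abs, abs_le]
  exact ⟨hx.1, hx.2.trans zero_le_one⟩

end Holomorphic

/-- The derivatives `∂ₓ^m Pⁿ f` in terms of the sequence `f m = ∂ₓ^m f`, with `n` as the first
index. -/
def iterP (a : ℝ) (f : ℕ → ℝ → ℝ) : ℕ → ℕ → ℝ → ℝ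
  | 0, m => f m
  | n + 1, m => fun x => iterP a f n (m + 3) x + a * iterP a f n (m + 1) x

section IterP

variable {a : ℝ} {f : ℕ → ℝ → ℝ} {y : ℝ → ℝ}

theorem IsDerivSeq.iterP {s : Set ℝ} (hf : IsDerivSeq s f) (n : ℕ) :
    IsDerivSeq s (iterP a f n) := by
  induction n with
  | zero => exact hf
  | succ n ih => exact fun m x hx => (ih (m + 3) x hx).add ((ih (m + 1) x hx).const_mul a)

theorem eqOn_iterate_P (hf : IsDerivSeq (Icc (-1) 0) f) (hy : EqOn y (f 0) (Icc (-1) 0)) (n : ℕ) :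
    EqOn ((P a)^[n] y) (iterP a f n 0) (Icc (-1) 0) := by
  induction n with
  | zero => exact hy
  | succ n ih =>
    intro x hx
    have hderiv := (hf.iterP (a := a) n).iteratedDerivWithin_eq (uniqueDiffOn_Icc (by norm_num))
    rw [Function.iterate_succ_apply', P, ← iteratedDerivWithin_one,
      iteratedDerivWithin_congr ih hx, iteratedDerivWithin_congr ih hx, hderiv 3 0 hx,
      hderiv 1 0 hx]
    rfl

theorem derivWithin_iterate_P_eq (hf : IsDerivSeq (Icc (-1) 0) f)
    (hy : EqOn y (f 0) (Icc (-1) 0)) (n : ℕ) {x : ℝ} (hx : x ∈ Icc (-1 : ℝ) 0) :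
    derivWithin ((P a)^[n] y) (Icc (-1) 0) x = iterP a f n 1 x := by
  have heq := eqOn_iterate_P (a := a) hf hy n
  rw [derivWithin_congr heq (heq hx)]
  exact (hf.iterP n 0 x hx).derivWithin (uniqueDiffOn_Icc (by norm_num) x hx)

theorem abs_iterP_le {x C ε : ℝ} {b : ℕ → ℝ} (hC : 0 ≤ C) (hε : 0 ≤ ε)
    (hb : ∀ m, |a| * b (m + 1) ≤ ε * b (m + 3)) (hf : ∀ m, |f m x| ≤ C * b m) (n m : ℕ) :
    |iterP a f n m x| ≤ C * (1 + ε) ^ n * b (m + 3 * n) := by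
  induction n generalizing m with
  | zero => simpa [iterP] using hf m
  | succ n ih =>
    calc |iterP a f n (m + 3) x + a * iterP a f n (m + 1) x|
        ≤ |iterP a f n (m + 3) x| + |a| * |iterP a f n (m + 1) x| := by
          rw [← abs_mul]
          exact abs_add_le _ _
      _ ≤ C * (1 + ε) ^ n * b (m + 3 + 3 * n) + |a| * (C * (1 + ε) ^ n * b (m + 1 + 3 * n)) := by
          gcongr
          · exact ih _
          · exact ih _
      _ = C * (1 + ε) ^ n * (b (m + 3 * n + 3) + |a| * b (m + 3 * n + 1)) := by ring_nf
      _ ≤ C * (1 + ε) ^ n * (b (m + 3 * n + 3) + ε * b (m + 3 * n + 3)) := by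
          gcongr C * (1 + ε) ^ n * (b (m + 3 * n + 3) + ?_)
          exact hb _
      _ = C * (1 + ε) ^ (n + 1) * b (m + 3 * (n + 1)) := by ring_nf

-- Enlarging `m!` to `(m + K)!` makes the first-order term of `P` negligible against the
-- third-order one, so that the growth rate does not depend on `a`.
theorem exists_abs_iterP_two_le (a : ℝ) {x C r ε : ℝ} (hC : 0 ≤ C) (hr : 0 < r) (hε : 0 < ε)
    (hf : ∀ m, |f m x| ≤ C * r⁻¹ ^ m * m.factorial) :
    ∃ (C' : ℝ) (N : ℕ), ∀ n,
      |iterP a f n 2 x| ≤ C' * ((1 + ε) / r ^ 3) ^ n * (3 * n + N).factorial := by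
  obtain ⟨K, hK⟩ := exists_nat_ge (|a| * r ^ 2 / ε)
  rw [div_le_iff₀ hε] at hK
  refine ⟨C * r⁻¹ ^ 2, 2 + K, fun n => ?_⟩
  refine (abs_iterP_le (b := fun m => r⁻¹ ^ m * (m + K).factorial) hC hε.le (fun m => ?_)
    (fun m => ?_) n 2).trans_eq ?_
  · have hfac : ((m + 3 + K).factorial : ℝ)
        = (m + 1 + K + 2) * ((m + 1 + K + 1) * (m + 1 + K).factorial) := by
      rw [show m + 3 + K = m + 1 + K + 1 + 1 by ring, Nat.factorial_succ, Nat.factorial_succ]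
      push_cast
      ring
    have hle : |a| * r ^ 2 ≤ ε * ((m + 1 + K + 2) * (m + 1 + K + 1)) := by
      have : (K : ℝ) ≤ (m + 1 + K + 2) * (m + 1 + K + 1) := by
        have : (0 : ℝ) ≤ m := m.cast_nonneg
        nlinarith [(K.cast_nonneg : (0 : ℝ) ≤ K)]
      nlinarith
    calc |a| * (r⁻¹ ^ (m + 1) * (m + 1 + K).factorial)
        = |a| * r ^ 2 * (r⁻¹ ^ (m + 3) * (m + 1 + K).factorial) := by
          rw [pow_add r⁻¹ (m + 1) 2, inv_pow r 2]; field_simp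
      _ ≤ ε * ((m + 1 + K + 2) * (m + 1 + K + 1)) * (r⁻¹ ^ (m + 3) * (m + 1 + K).factorial) := by
          gcongr
      _ = ε * (r⁻¹ ^ (m + 3) * (m + 3 + K).factorial) := by rw [hfac]; ring
  · refine (hf m).trans ?_
    rw [mul_assoc]
    gcongr
    omega
  · rw [show 2 + 3 * n + K = 3 * n + (2 + K) by ring, pow_add, pow_mul, div_eq_mul_inv,
      mul_pow, inv_pow r 3]
    ring

end IterP

/-! ### Reachability -/

section Reachability

variable {a T R : ℝ} {y₁ : ℝ → ℝ}

theorem exists_flow_of_mem_reachClass (hR : 1 < R) (hy₁ : y₁ ∈ reachClass a R) :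
    ∃ Y, IsFlow a (Ici 0) Y ∧ EqOn (fun x => Y 0 0 x 0) y₁ (Icc (-1) 0) ∧
      ∀ t₁ > 0, ∃ K L : ℝ, 0 ≤ K ∧ 0 ≤ L ∧
        ∀ n t, t₁ ≤ t → |Y 2 n 0 t| ≤ K * L ^ n * n.factorial := by
  obtain ⟨-, ⟨z, hz, hzy⟩, hP⟩ := hy₁
  have hmem : (0 : ℝ) ∈ Icc (-1 : ℝ) 0 := by norm_num
  set f : ℕ → ℝ → ℝ := fun m x => (iteratedDeriv m z x).re
  have hf : IsDerivSeq (Icc (-1) 0) f := isDerivSeq_re_iteratedDeriv Metric.isOpen_ball hz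
    fun x hx => mem_ball_zero_iff.2 ((norm_ofReal_le_one_of_mem hx).trans_lt hR)
  have hy : EqOn y₁ (f 0) (Icc (-1) 0) := fun x hx => by
    simp only [f, iteratedDeriv_zero, ← hzy x hx, Complex.ofReal_re]
  obtain ⟨r, hr, hrR⟩ := exists_between hR
  obtain ⟨M, hM, hcauchy⟩ := exists_norm_iteratedDeriv_le (by linarith) hrR hz
  have hbound (m : ℕ) (x : ℝ) (hx : x ∈ Icc (-1 : ℝ) 0) :
      |f m x| ≤ M * (r - 1)⁻¹ ^ m * m.factorial :=
    (Complex.abs_re_le_norm _).trans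
      (hcauchy m x _ (by linarith) (by linarith [norm_ofReal_le_one_of_mem hx]))
  have hbound_zero (m : ℕ) : |f m 0| ≤ M * r⁻¹ ^ m * m.factorial :=
    (Complex.abs_re_le_norm _).trans (hcauchy m (0 : ℝ) r (by linarith) (by simp))
  have hr3 : 1 < r ^ 3 := one_lt_pow₀ hr (by norm_num)
  obtain ⟨C, N, hd⟩ := exists_abs_iterP_two_le a hM (by linarith)
    (by linarith : 0 < (r ^ 3 - 1) / 2) hbound_zero
  obtain ⟨Y, hY, hY2, hYK⟩ := exists_flow_of_trace_derivatives a (by positivity)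
    ((div_lt_one (by linarith)).2 (by linarith)) hd
  refine ⟨Y, hY, EqOn.trans ?_ hy.symm, hYK⟩
  exact hY.eqOn_of_recursion self_mem_Ici (f := fun m n => iterP a f n m) hf hM
    (inv_nonneg.2 (by linarith)) hbound (fun _ _ => rfl)
    (fun n => by rw [← eqOn_iterate_P hf hy n hmem, (hP n).1])
    (fun n => by rw [← derivWithin_iterate_P_eq hf hy n hmem, (hP n).2]) hY2

theorem exists_flow_connecting_zero (hT : 0 < T) (hR : 1 < R) (hy₁ : y₁ ∈ reachClass a R) :
    ∃ Y, IsFlow a (Icc 0 T) Y ∧ EqOn (fun x => Y 0 0 x 0) y₁ (Icc (-1) 0) ∧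
      ∀ x ∈ Icc (-1 : ℝ) 0, Y 0 0 x T = 0 := by
  obtain ⟨Z, hZ, hZ0, hZK⟩ := exists_flow_of_mem_reachClass hR hy₁
  obtain ⟨K, L, hK, hL, hb⟩ := hZK (T / 4) (by linarith)
  obtain ⟨χ, hχ, hχ0, hχ1, hχ1'⟩ := exists_cutoff (t₁ := T / 4) (t₂ := 3 * T / 4) (by linarith)
  set w := leibniz χ fun n t => Z 2 n 0 t
  have hw : IsGevreyTwo w := by
    refine isGevreyTwo_leibniz_cutoff (K := K) (by linarith) hχ hχ0 hL (fun n t ht => ?_)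
      fun n t ht => (hb n t ht).trans ?_
    · exact (hZ.derivSeq_t 2 0 (by norm_num) n t (mem_Ici.2 ht.le)).hasDerivAt (Ici_mem_nhds ht)
    · gcongr
      exact le_self_pow₀ (mod_cast n.factorial_pos) two_ne_zero
  obtain ⟨K', L', hL', hb'⟩ := hw.bound
  have hZT : IsFlow a (Icc 0 T) Z := hZ.mono Icc_subset_Ici_self
  have hW : IsFlow a (Icc 0 T) (fun m n x t => taylorFlow a (fun n => w n t) m n x) :=
    (isFlow_taylorFlow hw.isDerivSeq hL' hb').mono (subset_univ _)
  refine ⟨_, hZT.sub hW, fun x hx => ?_, fun x hx => ?_⟩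
  · have hw0 (n : ℕ) : w n 0 = 0 := leibniz_eq_zero_of_left (fun n => hχ0 n 0 (by linarith)) n
    simpa only [taylorFlow_eq_zero hw0, sub_zero] using hZ0 hx
  · have hwT (n : ℕ) : w n T = Z 2 n 0 T :=
      leibniz_of_eq_one (hχ1 T (by linarith)) (fun n => hχ1' n T (by linarith)) n
    refine sub_eq_zero.2 (hZT.eqOn_of_trace_eq hW (right_mem_Icc.2 hT.le) (fun n => ?_) hx)
    rw [taylorFlow_zero_right, taylorCoeff, hwT]

end Reachability

end LinearKdV

theorem theorem2_general (a T R : ℝ) (hT : 0 < T) (hR : 1 < R) (y₁ : ℝ → ℝ)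
    (hy₁ : y₁ ∈ LinearKdV.reachClass a R) :
    ∃ u : ℝ → ℝ, LinearKdV.Gevrey 3 0 T u ∧
      ∃ y : ℝ → ℝ → ℝ,
        LinearKdV.IsSolution a T u (fun _ => 0) y ∧
        (∀ v : ℝ → ℝ → ℝ, LinearKdV.IsSolution a T u (fun _ => 0) v →
          ∀ x ∈ Set.Icc (-1 : ℝ) 0, ∀ t ∈ Set.Icc 0 T, v x t = y x t) ∧
        (∀ x ∈ Set.Icc (-1 : ℝ) 0, y x T = y₁ x) ∧
        LinearKdV.GevreyRect 1 3 (-1) 0 0 T y := by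
  obtain ⟨Y, hY, hY0, hYT⟩ := LinearKdV.exists_flow_connecting_zero hT hR hy₁
  have hsol := hY.isSolution hT hYT
  refine ⟨_, hY.gevrey_left hT, _, hsol, fun v hv x hx t ht => hv.unique hT hsol hx ht,
    fun x hx => ?_, hY.gevreyRect hT⟩
  simpa only [sub_self] using hY0 hx

theorem theorem2 (a T R : ℝ) (ha : 0 ≤ a) (hT : 0 < T) (hR : LinearKdV.R₀ a < R)
    (y₁ : ℝ → ℝ) (hy₁ : y₁ ∈ LinearKdV.reachClass a R) :
    ∃ u : ℝ → ℝ, LinearKdV.Gevrey 3 0 T u ∧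
      ∃ y : ℝ → ℝ → ℝ,
        LinearKdV.IsSolution a T u (fun _ => 0) y ∧
        (∀ v : ℝ → ℝ → ℝ, LinearKdV.IsSolution a T u (fun _ => 0) v →
          ∀ x ∈ Set.Icc (-1 : ℝ) 0, ∀ t ∈ Set.Icc 0 T, v x t = y x t) ∧
        (∀ x ∈ Set.Icc (-1 : ℝ) 0, y x T = y₁ x) ∧
        LinearKdV.GevreyRect 1 3 (-1) 0 0 T y :=
  theorem2_general a T R hT ((LinearKdV.one_lt_R₀ ha).trans hR) y₁ hy₁
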